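/- Let $(V,\omega,H)$ be a linear Hamiltonian system: $V$ is a finite-dimensional real vector space, $\omega$ a symplectic form on $V$, and $H$ a quadratic form on $V$. Let $L$ be the linear operator defined by $\omega(x,Ly)=B_H(x,y)$, where $B_H$ is the symmetric bilinear form with $B_H(x,x)=H(x)$; the eigenvalues of the system are the complex eigenvalues of $L$. The codimension of the system is the codimension, in the Lie algebra $\mathfrak{sp}(V,\omega)$, of the family of operators with the same Jordan type as $L$ (the eigenvalues being allowed to vary), that is, $\operatorname{codim}\{[B,L] : B\in\mathfrak{sp}(V,\omega)\}-m$, where $m$ is the number of moduli: each pair $\pm a$ or $\pm ib$ of non-zero real or imaginary eigenvalues contributes $1$ to $m$, each quadruplet $\pm a\pm ib$ with $a,b\neq0$ contributes $2$, and the eigenvalue $0$ contributes $0$. Suppose that $H$ has signature $0$ and that the system has codimension at most $1$. Then $(V,\omega,H)$ splits as a direct sum $\bigoplus_{j=1}^r (V_j,\omega_j,H_j)$ of symplectic subsystems such that the set of eigenvalues of the $j$-th subsystem is a quadruplet $\{\lambda_j,-\lambda_j,\bar\lambda_j,-\bar\lambda_j\}$ and these quadruplets are distinct for different $j$. For every such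 splitting, each $V_j$ has dimension $2$ or $4$; each $\lambda_j$ is non-zero; if $\dim V_j=2$ then $\lambda_j$ is real or imaginary; and if $\dim V_j=4$ and $\lambda_j$ is real or imaginary, then $\lambda_j$ has algebraic multiplicity $2$ and geometric multiplicity $1$. Define $$\delta(j)=\begin{cases}0 & \dim V_j=2,\ \lambda_j \text{ imaginary},\\ 1 & \dim V_j=4,\ \lambda_j\text{ imaginary},\\ 2 & \dim V_j=4,\ \operatorname{Re}\lambda_j\neq0\neq\operatorname{Im}\lambda_j,\\ 3 & \dim V_j=4,\ \lambda_j \text{ real},\\ 2 & \dim V_j=2,\ \lambda_j\text{ real}.\end{cases}$$ Then the number of Lagrangian subspaces of $V$ contained in the null-cone $\mathcal N=H^{-1}(0)$ is exactly $\prod_{j=1}^r\delta(j)$ (in particular it is finite). -/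

import Mathlib

noncomputable section

open scoped TensorProduct

/-- A linear Hamiltonian system on a real vector space `V`: a symplectic form `ω`
and a quadratic Hamiltonian `H` (possibly degenerate). -/
structure LinearHamiltonianSystem (V : Type*) [AddCommGroup V] [Module ℝ V] where
  /-- the symplectic form -/
  ω : LinearMap.BilinForm ℝ V
  /-- the Hamiltonian -/
  H : QuadraticForm ℝ V
  isAlt : ω.IsAlt
  nondegenerate : ω.Nondegenerate

namespace LinearHamiltonianSystem

variable {V : Type*} [AddCommGroup V] [Module ℝ V] [FiniteDimensional ℝ V]

/-- The linear vector field `L = Ω⁻¹ S`, where `H x = xᵀ S x` and `ω x y = xᵀ Ω y`.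
See `ω_vectorField` for the defining property `ω x (L y) = xᵀ S y`. -/
def vectorField (S : LinearHamiltonianSystem V) : Module.End ℝ V :=
  -((S.ω.toDual S.nondegenerate).symm.toLinearMap ∘ₗ QuadraticMap.associated S.H)

theorem ω_vectorField (S : LinearHamiltonianSystem V) (x y : V) :
    S.ω x (S.vectorField y) = QuadraticMap.associated (R := ℝ) S.H x y := by
  have h : S.ω (S.vectorField y) x = -QuadraticMap.associated (R := ℝ) S.H y x := by
    simp [vectorField, LinearMap.BilinForm.apply_toDual_symm_apply]
  have h2 := S.isAlt.neg_eq (S.vectorField y) x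
  rw [← h2, h, neg_neg]
  exact (QuadraticMap.associated_isSymm ℝ S.H) y x

/-- The complexification of the vector field. -/
def complexVectorField (S : LinearHamiltonianSystem V) : Module.End ℂ (ℂ ⊗[ℝ] V) :=
  S.vectorField.baseChange ℂ

/-- The set of (complex) eigenvalues of the system. -/
def eigenvalues (S : LinearHamiltonianSystem V) : Set ℂ :=
  {z | S.complexVectorField.HasEigenvalue z}

/-- Algebraic multiplicity of `z` as an eigenvalue of the system. -/
def algMultiplicity (S : LinearHamiltonianSystem V) (z : ℂ) : ℕ :=
  S.complexVectorField.charpoly.rootMultiplicity z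

/-- Geometric multiplicity of `z` as an eigenvalue of the system. -/
def geomMultiplicity (S : LinearHamiltonianSystem V) (z : ℂ) : ℕ :=
  Module.finrank ℂ (S.complexVectorField.eigenspace z)

/-- The Lie algebra `sp(V, ω)` of Hamiltonian operators: `ω (A x) y = -ω x (A y)`. -/
def hamiltonianOperators (S : LinearHamiltonianSystem V) : Submodule ℝ (Module.End ℝ V) :=
  S.ω.skewAdjointSubmodule

theorem vectorField_mem (S : LinearHamiltonianSystem V) :
    S.vectorField ∈ S.hamiltonianOperators := by
  rw [hamiltonianOperators, LinearMap.mem_skewAdjointSubmodule]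
  intro x y
  change S.ω (S.vectorField x) y = S.ω x (-S.vectorField y)
  rw [map_neg, ω_vectorField, ← S.isAlt.neg_eq, ω_vectorField]
  exact congrArg Neg.neg ((QuadraticMap.associated_isSymm ℝ S.H) y x)

/-- The tangent space at `L` to the orbit of `L` under conjugation by the symplectic group,
namely `{B L - L B | B ∈ sp(V, ω)}`. -/
def orbitTangentSpace (S : LinearHamiltonianSystem V) : Submodule ℝ (Module.End ℝ V) :=
  S.hamiltonianOperators.map
    (LinearMap.mulRight ℝ S.vectorField - LinearMap.mulLeft ℝ S.vectorField)

/-- The number of real parameters (moduli) on which the eigenvalues depend when the Jordan type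
is kept: one for each pair `±a` or `±ib` of nonzero real or imaginary eigenvalues, two for each
quadruplet `±a ± ib` with `a, b ≠ 0`, none for the eigenvalue `0`. It is counted here as the
number of distinct nonzero eigenvalues modulo `z ↦ -z`. -/
def moduliNumber (S : LinearHamiltonianSystem V) : ℕ :=
  {z ∈ S.eigenvalues | 0 < z.re ∨ (z.re = 0 ∧ 0 < z.im)}.ncard

/-- The codimension of the system: the codimension in `sp(V, ω)` of the family of all systems
of the same Jordan type (with arbitrary eigenvalues), that is the codimension of the symplectic
orbit minus the number of moduli. -/
def codimension (S : LinearHamiltonianSystem V) : ℤ :=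
  (Module.finrank ℝ S.hamiltonianOperators : ℤ) - Module.finrank ℝ S.orbitTangentSpace
    - S.moduliNumber

/-- The signature of `H`: positive minus negative index of inertia. -/
def signature (S : LinearHamiltonianSystem V) : ℤ := (sigPos S.H : ℤ) - sigNeg S.H

/-- The null-cone `H⁻¹(0)`. -/
def nullCone (S : LinearHamiltonianSystem V) : Set V := {x | S.H x = 0}

/-- Lagrangian subspaces: those equal to their own symplectic orthogonal. -/
def IsLagrangian (S : LinearHamiltonianSystem V) (W : Submodule ℝ V) : Prop :=
  S.ω.orthogonal W = W

/-- The subsystem on a symplectic subspace `W`. -/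
def restrict (S : LinearHamiltonianSystem V) (W : Submodule ℝ V)
    (hW : (S.ω.restrict W).Nondegenerate) : LinearHamiltonianSystem W where
  ω := S.ω.restrict W
  H := S.H.restrict W
  isAlt := fun x => S.isAlt x
  nondegenerate := hW

/-- The eigenvalue quadruplet `{z, -z, z̄, -z̄}`. -/
def quadruplet (z : ℂ) : Set ℂ :=
  {z, -z, (starRingEnd ℂ) z, -(starRingEnd ℂ) z}

/-- A splitting of a system as a direct sum of `r` symplectic subsystems, the eigenvalues of the
`j`-th one forming a single quadruplet, different components having different quadruplets. -/
structure Splitting (S : LinearHamiltonianSystem V) (r : ℕ) where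
  /-- the components `V_j` -/
  comp : Fin r → Submodule ℝ V
  isInternal : DirectSum.IsInternal comp
  symplectic : ∀ j, (S.ω.restrict (comp j)).Nondegenerate
  ω_eq_zero : ∀ i j, i ≠ j → ∀ x ∈ comp i, ∀ y ∈ comp j, S.ω x y = 0
  H_add : ∀ i j, i ≠ j → ∀ x ∈ comp i, ∀ y ∈ comp j, S.H (x + y) = S.H x + S.H y
  /-- a representative `λ_j` of the `j`-th quadruplet -/
  eigenvalue : Fin r → ℂ
  eigenvalues_eq : ∀ j,
    (S.restrict (comp j) (symplectic j)).eigenvalues = quadruplet (eigenvalue j)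
  distinct : ∀ i j, i ≠ j → quadruplet (eigenvalue i) ≠ quadruplet (eigenvalue j)

/-- The `j`-th subsystem `(V_j, ω_j, H_j)` of a splitting. -/
def Splitting.subsystem {S : LinearHamiltonianSystem V} {r : ℕ} (D : S.Splitting r) (j : Fin r) :
    LinearHamiltonianSystem (D.comp j) :=
  S.restrict (D.comp j) (D.symplectic j)

open Classical in
/-- The factor attached to a component of dimension `d` with eigenvalue `z ≠ 0`. -/
def factor (d : ℕ) (z : ℂ) : ℕ :=
  if d = 2 ∧ z.re = 0 then 0
  else if d = 4 ∧ z.re = 0 then 1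
  else if d = 4 ∧ z.re ≠ 0 ∧ z.im ≠ 0 then 2
  else if d = 4 ∧ z.im = 0 then 3
  else if d = 2 ∧ z.im = 0 then 2
  else 0

/-- The function `δ(j)` of a splitting. -/
def Splitting.δ {S : LinearHamiltonianSystem V} {r : ℕ} (D : S.Splitting r) (j : Fin r) : ℕ :=
  factor (Module.finrank ℝ (D.comp j)) (D.eigenvalue j)

end LinearHamiltonianSystem

end

/-!
Since `H` has even signature, the kernel of `L` has even dimension; it contributes to the
codimension without contributing a modulus, so codimension at most `1` makes `L` invertible, and
each summand of a splitting is nonderogatory with characteristic polynomial the power, of degree at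
most `4`, of one `L`-minimal even polynomial. A Lagrangian subspace lies in the null-cone exactly
when it is `L`-invariant, and for nonderogatory `L` the invariant subspaces are the kernels
`ker p(L)` for `p` dividing the characteristic polynomial `χ`. The orthogonal of `ker p(L)` is the
range of `p(-L)`, so such a kernel is Lagrangian exactly when `p(X) p(-X) = ± χ`. In each summand
the count is thus one of factorizations, and invariant subspaces are sums of their intersections
with the summands, so the counts multiply.
-/

noncomputable section

open scoped TensorProduct
open LinearMap (BilinForm)
open Module Polynomial

section LinearAlgebra

variable {K V W : Type*} [Field K] [AddCommGroup V] [Module K V] [AddCommGroup W] [Module K W]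

theorem finrank_map_add_finrank_inf_ker [FiniteDimensional K V] (f : V →ₗ[K] W)
    (p : Submodule K V) :
    finrank K (p.map f) + finrank K (p ⊓ LinearMap.ker f : Submodule K V) = finrank K p := by
  have h := LinearMap.finrank_range_add_finrank_ker (f.domRestrict p)
  rwa [LinearMap.range_domRestrict, LinearMap.ker_domRestrict, ← Submodule.finrank_map_subtype_eq p,
    Submodule.map_comap_subtype] at h

theorem finrank_ker_mul_le [FiniteDimensional K V] (f g : End K V) :
    finrank K (LinearMap.ker (f * g)) ≤
      finrank K (LinearMap.ker f) + finrank K (LinearMap.ker g) := by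
  rw [← finrank_map_add_finrank_inf_ker g (LinearMap.ker (f * g))]
  refine Nat.add_le_add (Submodule.finrank_mono ?_) (Submodule.finrank_mono inf_le_right)
  rintro _ ⟨x, hx, rfl⟩
  exact hx

theorem aeval_apply_mem {f : End K V} {W : Submodule K V} (hW : W ∈ f.invtSubmodule) (p : K[X])
    {x : V} (hx : x ∈ W) : aeval f p x ∈ W := by
  induction p using Polynomial.induction_on generalizing x with
  | C a => simpa using W.smul_mem a hx
  | add p q hp hq => simpa using W.add_mem (hp hx) (hq hx)
  | monomial n a ih =>
    rw [pow_succ, ← mul_assoc, map_mul, End.mul_apply, aeval_X]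
    exact ih (hW hx)

theorem aeval_apply_comm (f : End K V) (p : K[X]) (x : V) : aeval f p (f x) = f (aeval f p x) := by
  have h := congrArg (aeval f) (mul_comm p X)
  rw [map_mul, map_mul, aeval_X] at h
  exact LinearMap.congr_fun h x

theorem ker_aeval_mem_invtSubmodule (f : End K V) (p : K[X]) :
    LinearMap.ker (aeval f p) ∈ f.invtSubmodule := fun x hx => by
  rw [Submodule.mem_comap, LinearMap.mem_ker, aeval_apply_comm, LinearMap.mem_ker.1 hx, map_zero]

theorem aeval_apply_of_intertwine {f : End K V} {g : End K W} {i : W →ₗ[K] V}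
    (h : ∀ y, f (i y) = i (g y)) (p : K[X]) (y : W) : aeval f p (i y) = i (aeval g p y) := by
  induction p using Polynomial.induction_on generalizing y with
  | C a => simp
  | add p q hp hq => simp [hp, hq]
  | monomial n a ih =>
    rw [pow_succ, ← mul_assoc, map_mul (aeval f), map_mul (aeval g), End.mul_apply, End.mul_apply,
      aeval_X, aeval_X, h, ih]

theorem ker_aeval_le_of_dvd (f : End K V) {p q : K[X]} (h : p ∣ q) :
    LinearMap.ker (aeval f p) ≤ LinearMap.ker (aeval f q) := by
  obtain ⟨r, rfl⟩ := h
  rw [mul_comm, map_mul, End.mul_eq_comp]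
  exact LinearMap.ker_le_ker_comp _ _

theorem ker_aeval_X_sub_C (f : End K V) (a : K) :
    LinearMap.ker (aeval f (X - C a)) = f.eigenspace a := by
  rw [End.eigenspace_def, map_sub, aeval_X, aeval_C, Algebra.algebraMap_eq_smul_one]

end LinearAlgebra

section Nonderogatory

variable {K V : Type*} [Field K] [AddCommGroup V] [Module K V] {f : End K V}

/-- Nonderogatory operators: over an algebraically closed field, those whose eigenspaces are at
most one-dimensional. The condition is phrased through the kernels of all polynomials in the
operator so that it makes sense over any field. -/
def IsNonderogatory (f : End K V) : Prop :=
  ∀ p : K[X], p ≠ 0 → finrank K (LinearMap.ker (aeval f p)) ≤ p.natDegree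

theorem IsNonderogatory.finrank_eigenspace_le_one (hf : IsNonderogatory f) (a : K) :
    finrank K (f.eigenspace a) ≤ 1 := by
  rw [← ker_aeval_X_sub_C, ← natDegree_X_sub_C a]
  exact hf _ (X_sub_C_ne_zero a)

variable [FiniteDimensional K V]

theorem isNonderogatory_of_finrank_eigenspace_le_one [IsAlgClosed K]
    (hf : ∀ a, finrank K (f.eigenspace a) ≤ 1) : IsNonderogatory f := fun p hp => by
  have hsplit := IsAlgClosed.splits p
  suffices h : ∀ s : Multiset K,
      finrank K (LinearMap.ker (aeval f (s.map fun a => X - C a).prod)) ≤ s.card by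
    rw [hsplit.natDegree_eq_card_roots]
    refine (Submodule.finrank_mono (ker_aeval_le_of_dvd f ?_)).trans (h p.roots)
    conv_lhs => rw [hsplit.eq_prod_roots]
    exact (C_mul_dvd (leadingCoeff_ne_zero.2 hp)).2 dvd_rfl
  intro s
  induction s using Multiset.induction with
  | empty =>
    rw [Multiset.map_zero, Multiset.prod_zero, map_one, End.one_eq_id, LinearMap.ker_id,
      finrank_bot, Multiset.card_zero]
  | cons a s ih =>
    rw [Multiset.map_cons, Multiset.prod_cons, Multiset.card_cons, map_mul, add_comm]
    refine (finrank_ker_mul_le _ _).trans (Nat.add_le_add ?_ ih)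
    rw [ker_aeval_X_sub_C]
    exact hf a

namespace IsNonderogatory

theorem finrank_ker_aeval (hf : IsNonderogatory f) {p : K[X]} (hp : p ∣ f.charpoly) :
    finrank K (LinearMap.ker (aeval f p)) = p.natDegree := by
  obtain ⟨q, hq⟩ := hp
  have hpq : p * q ≠ 0 := hq ▸ f.charpoly_monic.ne_zero
  have hdeg : p.natDegree + q.natDegree = finrank K V := by
    rw [← f.charpoly_natDegree, hq, natDegree_mul' (by simpa using hpq)]
  have hker := finrank_ker_mul_le (aeval f p) (aeval f q)
  rw [← map_mul, ← hq, LinearMap.aeval_self_charpoly, LinearMap.ker_zero, finrank_top] at hker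
  have hp := hf p (left_ne_zero_of_mul hpq)
  have hq := hf q (right_ne_zero_of_mul hpq)
  omega

theorem dvd_of_ker_aeval_le (hf : IsNonderogatory f) {p q : K[X]} (hp0 : p ≠ 0)
    (hp : p.natDegree ≤ finrank K (LinearMap.ker (aeval f p)))
    (h : LinearMap.ker (aeval f p) ≤ LinearMap.ker (aeval f q)) : p ∣ q := by
  classical
  have hg0 : EuclideanDomain.gcd p q ≠ 0 := fun h0 => hp0 (EuclideanDomain.gcd_eq_zero_iff.1 h0).1
  have hker : LinearMap.ker (aeval f p) ≤ LinearMap.ker (aeval f (EuclideanDomain.gcd p q)) :=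
    fun x hx => by
      rw [LinearMap.mem_ker, EuclideanDomain.gcd_eq_gcd_ab, mul_comm p, mul_comm q, map_add,
        map_mul, map_mul, LinearMap.add_apply, End.mul_apply, End.mul_apply, LinearMap.mem_ker.1 hx,
        LinearMap.mem_ker.1 (h hx), map_zero, map_zero, add_zero]
  have hdeg := hp.trans ((Submodule.finrank_mono hker).trans (hf _ hg0))
  have hassoc := associated_of_dvd_of_natDegree_le (EuclideanDomain.gcd_dvd_left p q) hp0 hdeg
  exact hassoc.symm.dvd.trans (EuclideanDomain.gcd_dvd_right p q)

theorem charpoly_dvd_of_aeval_eq_zero (hf : IsNonderogatory f) {p : K[X]}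
    (hp : aeval f p = 0) : f.charpoly ∣ p := by
  refine hf.dvd_of_ker_aeval_le f.charpoly_monic.ne_zero (hf.finrank_ker_aeval dvd_rfl).ge ?_
  rw [hp, LinearMap.ker_zero]
  exact le_top

theorem exists_eq_ker_aeval (hf : IsNonderogatory f) {W : Submodule K V}
    (hW : W ∈ f.invtSubmodule) :
    ∃ p : K[X], p.Monic ∧ p ∣ f.charpoly ∧ W = LinearMap.ker (aeval f p) := by
  let p := (f.restrict hW).charpoly
  have hp : p.Monic := LinearMap.charpoly_monic _
  have hle : W ≤ LinearMap.ker (aeval f p) := fun x hx => by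
    have h := aeval_apply_of_intertwine (f := f) (g := f.restrict hW) (i := W.subtype)
      (fun _ => rfl) p ⟨x, hx⟩
    rwa [LinearMap.aeval_self_charpoly, LinearMap.zero_apply, map_zero] at h
  have hdeg : p.natDegree = finrank K W := LinearMap.charpoly_natDegree _
  refine ⟨p, hp, hf.dvd_of_ker_aeval_le hp.ne_zero ?_ ?_,
    Submodule.eq_of_le_of_finrank_le hle (hdeg ▸ hf p hp.ne_zero)⟩
  · exact hdeg ▸ Submodule.finrank_mono hle
  · rw [LinearMap.aeval_self_charpoly, LinearMap.ker_zero]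
    exact le_top

end IsNonderogatory

end Nonderogatory

section BilinearForms

variable {K V : Type*} [Field K] [AddCommGroup V] [Module K V] {B : BilinForm K V}
  {f g : End K V}

theorem isSkewAdjoint_iff : B.IsSkewAdjoint f ↔ ∀ x y, B (f x) y = -B x (f y) := by
  simp [LinearMap.IsSkewAdjoint, LinearMap.IsAdjointPair]

theorem isAdjointPair_aeval (h : LinearMap.IsAdjointPair B B f g) (p : K[X]) :
    LinearMap.IsAdjointPair B B (aeval f p) (aeval g p) := by
  induction p using Polynomial.induction_on with
  | C a => intro x y; simp
  | add p q hp hq => rw [map_add, map_add]; exact hp.add hq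
  | monomial n a ih =>
    have hg : aeval g (C a * X ^ (n + 1)) = g * aeval g (C a * X ^ n) := by
      rw [pow_succ', mul_left_comm, map_mul, aeval_X]
    rw [hg, pow_succ, ← mul_assoc, map_mul, aeval_X]
    exact ih.mul h

theorem isAdjointPair_aeval_comp_neg_X (h : B.IsSkewAdjoint f) (p : K[X]) :
    LinearMap.IsAdjointPair B B (aeval f p) (aeval f (p.comp (-X))) := by
  rw [aeval_comp, map_neg, aeval_X]
  exact isAdjointPair_aeval (g := -f) h p

theorem orthogonal_range_of_isAdjointPair (hB : B.Nondegenerate)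
    (h : LinearMap.IsAdjointPair B B f g) :
    B.orthogonal (LinearMap.range f) = LinearMap.ker g := by
  ext y
  rw [BilinForm.mem_orthogonal_iff, LinearMap.mem_ker]
  refine ⟨fun hy => hB.2 _ fun x => ?_, ?_⟩
  · rw [← h x y]
    exact hy _ ⟨x, rfl⟩
  · rintro hy _ ⟨x, rfl⟩
    rw [h x y, hy, map_zero]

theorem finrank_ker_eq_of_isAdjointPair [FiniteDimensional K V] (hB : B.Nondegenerate)
    (h : LinearMap.IsAdjointPair B B f g) :
    finrank K (LinearMap.ker f) = finrank K (LinearMap.ker g) := by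
  have h₁ := BilinForm.finrank_orthogonal hB (LinearMap.range f)
  have h₂ := LinearMap.finrank_range_add_finrank_ker f
  rw [orthogonal_range_of_isAdjointPair hB h] at h₁
  omega

theorem orthogonal_ker_of_isAdjointPair [FiniteDimensional K V] (hB : B.Nondegenerate)
    (h : LinearMap.IsAdjointPair B B f g) :
    B.orthogonal (LinearMap.ker f) = LinearMap.range g := by
  refine (Submodule.eq_of_le_of_finrank_eq ?_ ?_).symm
  · rintro _ ⟨y, rfl⟩
    refine BilinForm.mem_orthogonal_iff.2 fun x hx => (h x y).symm.trans ?_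
    rw [LinearMap.mem_ker.1 hx, map_zero, LinearMap.zero_apply]
  · have h₁ := BilinForm.finrank_orthogonal hB (LinearMap.ker f)
    have h₂ := LinearMap.finrank_range_add_finrank_ker g
    rw [← finrank_ker_eq_of_isAdjointPair hB h] at h₂
    omega

theorem natDegree_comp_neg_X (p : K[X]) : (p.comp (-X)).natDegree = p.natDegree := by
  rw [natDegree_comp, natDegree_neg, natDegree_X, mul_one]

theorem orthogonal_ker_aeval_eq_self_iff [FiniteDimensional K V] (hB : B.Nondegenerate)
    (hf : B.IsSkewAdjoint f) (hf' : IsNonderogatory f) {p : K[X]} (hp : p ∣ f.charpoly) :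
    B.orthogonal (LinearMap.ker (aeval f p)) = LinearMap.ker (aeval f p) ↔
      Associated (p * p.comp (-X)) f.charpoly := by
  have hdim := BilinForm.finrank_orthogonal hB (LinearMap.ker (aeval f p))
  have hle := Submodule.finrank_le (LinearMap.ker (aeval f p))
  have hp0 : p ≠ 0 := ne_zero_of_dvd_ne_zero f.charpoly_monic.ne_zero hp
  have hdeg : (p * p.comp (-X)).natDegree = 2 * p.natDegree := by
    rw [natDegree_mul' (by simpa using hp0), natDegree_comp_neg_X, two_mul]
  have hchar : f.charpoly.natDegree = finrank K V := f.charpoly_natDegree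
  rw [orthogonal_ker_of_isAdjointPair hB (isAdjointPair_aeval_comp_neg_X hf p)] at hdim ⊢
  rw [hf'.finrank_ker_aeval hp] at hdim hle
  have hzero : aeval f (p * p.comp (-X)) = 0 ↔
      LinearMap.range (aeval f (p.comp (-X))) ≤ LinearMap.ker (aeval f p) := by
    rw [map_mul, LinearMap.range_le_ker_iff]
    rfl
  refine ⟨fun h => ?_, fun h => Submodule.eq_of_le_of_finrank_eq (hzero.1 ?_) ?_⟩
  · rw [h, hf'.finrank_ker_aeval hp] at hdim
    exact (associated_of_dvd_of_natDegree_le (hf'.charpoly_dvd_of_aeval_eq_zero (hzero.2 h.le))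
      (mul_ne_zero hp0 (by simpa using hp0)) (by omega)).symm
  · obtain ⟨q, hq⟩ := h.symm.dvd
    rw [hq, map_mul, LinearMap.aeval_self_charpoly, zero_mul]
  · rw [hf'.finrank_ker_aeval hp]
    have := natDegree_eq_of_degree_eq (degree_eq_degree_of_associated h)
    omega

theorem finrank_eigenspace_neg [FiniteDimensional K V] (hB : B.Nondegenerate)
    (hf : B.IsSkewAdjoint f) (a : K) :
    finrank K (f.eigenspace (-a)) = finrank K (f.eigenspace a) := by
  have h : LinearMap.IsAdjointPair B B (f - (-a) • 1 : End K V) (-(f - a • 1) : End K V) :=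
    fun x y => by
      simp only [neg_smul, sub_neg_eq_add, LinearMap.add_apply, LinearMap.smul_apply,
        End.one_apply, map_add, map_smul, isSkewAdjoint_iff.1 hf x y, smul_eq_mul, neg_sub,
        LinearMap.sub_apply, map_sub]
      ring
  rw [End.eigenspace_def, End.eigenspace_def, finrank_ker_eq_of_isAdjointPair hB h,
    LinearMap.ker_neg]

theorem even_finrank_of_isAlt [NeZero (2 : K)] [FiniteDimensional K V] (hB : B.IsAlt)
    (hn : B.Nondegenerate) : Even (finrank K V) := by
  let b := Module.finBasis K V
  have hdet : (LinearMap.BilinForm.toMatrix b B).det ≠ 0 :=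
    (BilinForm.nondegenerate_iff_det_ne_zero b).1 hn
  have hT : (LinearMap.BilinForm.toMatrix b B).transpose = -LinearMap.BilinForm.toMatrix b B := by
    ext i j
    simp [LinearMap.BilinForm.toMatrix_apply, ← hB.neg_eq (b j) (b i)]
  by_contra hodd
  have h := congrArg Matrix.det hT
  rw [Matrix.det_transpose, Matrix.det_neg, Fintype.card_fin,
    (Nat.not_even_iff_odd.1 hodd).neg_one_pow, neg_one_mul, eq_neg_iff_add_eq_zero, ← two_mul] at h
  exact hdet ((mul_eq_zero.1 h).resolve_left two_ne_zero)

theorem charpoly_neg_comp_neg_X {n R : Type*} [Fintype n] [DecidableEq n] [CommRing R]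
    (A : Matrix n n R) :
    (-A).charpoly.comp (-X) = (-1) ^ Fintype.card n * A.charpoly := by
  rw [Matrix.charpoly, Matrix.charpoly, ← Matrix.det_neg, ← coe_compRingHom_apply,
    RingHom.map_det]
  congr 1
  refine Matrix.ext fun i j => ?_
  by_cases h : i = j
  · subst h
    simp only [RingHom.mapMatrix_apply, coe_compRingHom, Matrix.map_apply,
      Matrix.charmatrix_apply_eq, Matrix.neg_apply, map_neg, sub_neg_eq_add, add_comp, X_comp,
      C_comp, neg_sub]
    ring
  · simp [Matrix.charmatrix_apply_ne, h]

theorem charpoly_comp_neg_X_of_isSkewAdjoint [FiniteDimensional K V] (hB : B.Nondegenerate)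
    (hf : B.IsSkewAdjoint f) :
    f.charpoly.comp (-X) = (-1) ^ finrank K V * f.charpoly := by
  let b := Module.finBasis K V
  let M := LinearMap.BilinForm.toMatrix b B
  let F := LinearMap.toMatrix b b f
  have hM : IsUnit M := M.isUnit_iff_isUnit_det.2
    (isUnit_iff_ne_zero.2 ((BilinForm.nondegenerate_iff_det_ne_zero b).1 hB))
  have hskew : F.transpose * M = -(M * F) := by
    rw [← LinearMap.BilinForm.toMatrix_compLeft, ← LinearMap.BilinForm.toMatrix_compRight,
      ← map_neg]
    congr 1
    ext x y
    exact isSkewAdjoint_iff.1 hf x y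
  have hconj : F.charpoly = (-F).charpoly := by
    have h : M * (-F) * M⁻¹ = F.transpose := by
      rw [mul_neg, ← hskew, Matrix.mul_nonsing_inv_cancel_right _ _ (M.isUnit_iff_isUnit_det.1 hM)]
    rw [← F.charpoly_transpose, ← h]
    exact Matrix.charpoly_units_conj hM.unit (-F)
  rw [← LinearMap.charpoly_toMatrix f b, hconj, charpoly_neg_comp_neg_X, Fintype.card_fin, ← hconj]

end BilinearForms

section Polynomials

variable {K : Type*} [Field K]

theorem isCoprime_of_irreducible_of_monic_of_ne {p q : K[X]}
    (hp : Irreducible p) (hq : Irreducible q) (hpm : p.Monic) (hqm : q.Monic) (hne : p ≠ q) :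
    IsCoprime p q :=
  hp.coprime_iff_not_dvd.2 fun h =>
    hne (eq_of_monic_of_associated hpm hqm (hp.associated_of_dvd hq h))

theorem exists_comp_X_sq_eq_of_comp_neg_X_eq [NeZero (2 : K)] {p : K[X]} (hp : p.comp (-X) = p) :
    ∃ g : K[X], g.comp (X ^ 2) = p := by
  refine ⟨p.contract 2, ?_⟩
  rw [← expand_eq_comp_X_pow]
  ext n
  rw [coeff_expand two_pos, coeff_contract two_ne_zero]
  split_ifs with hn
  · rw [Nat.div_mul_cancel hn]
  · have h := congrArg (fun q => coeff q n) hp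
    have hX : (-X : K[X]) = C (-1) * X := by simp
    simp only [hX, comp_C_mul_X_coeff, (Nat.odd_iff.2 (Nat.two_dvd_ne_zero.1 hn)).neg_one_pow,
      mul_neg, mul_one] at h
    rw [neg_eq_iff_add_eq_zero, ← two_mul] at h
    exact ((mul_eq_zero.1 h).resolve_left two_ne_zero).symm

theorem dvd_pow_natDegree_of_aeval_eq_zero (L : Type*) [Field L] [IsAlgClosed L] [Algebra K L]
    {p q : K[X]} (hp : p ≠ 0) (h : ∀ a : L, aeval a p = 0 → aeval a q = 0) :
    p ∣ q ^ p.natDegree := by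
  have hsplit := IsAlgClosed.splits (p.map (algebraMap K L))
  have hp' : p.map (algebraMap K L) ≠ 0 := Polynomial.map_ne_zero hp
  rw [← map_dvd_map' (algebraMap K L), Polynomial.map_pow, ← natDegree_map (algebraMap K L),
    hsplit.natDegree_eq_card_roots, ← Multiset.prod_replicate, ← Multiset.map_const']
  conv_lhs => rw [hsplit.eq_prod_roots]
  refine (C_mul_dvd (leadingCoeff_ne_zero.2 hp')).2
    (Multiset.prod_dvd_prod_of_dvd _ _ fun a ha => ?_)
  rw [dvd_iff_isRoot, IsRoot, eval_map_algebraMap]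
  refine h a ?_
  rw [← eval_map_algebraMap]
  exact (mem_roots hp').1 ha

end Polynomials

section PrimaryDecomposition

variable {K V ι : Type*} [Field K] [AddCommGroup V] [Module K V] {f : End K V}

theorem ker_aeval_prod_le_iSup {p : ι → K[X]} (hp : Pairwise fun i j => IsCoprime (p i) (p j))
    (s : Finset ι) :
    LinearMap.ker (aeval f (∏ i ∈ s, p i)) ≤ ⨆ i ∈ s, LinearMap.ker (aeval f (p i)) := by
  classical
  induction s using Finset.induction with
  | empty =>
    rw [Finset.prod_empty, map_one, End.one_eq_id, LinearMap.ker_id]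
    exact bot_le
  | insert a s ha ih =>
    rw [Finset.prod_insert ha, Finset.iSup_insert, ← sup_ker_aeval_eq_ker_aeval_mul_of_coprime]
    · exact sup_le_sup le_rfl ih
    · exact IsCoprime.prod_right fun i hi => hp fun h => ha (h ▸ hi)

theorem isInternal_ker_aeval [Fintype ι] [DecidableEq ι] {p : ι → K[X]}
    (hp : Pairwise fun i j => IsCoprime (p i) (p j)) (hf : aeval f (∏ i, p i) = 0) :
    DirectSum.IsInternal fun i => LinearMap.ker (aeval f (p i)) := by
  rw [DirectSum.isInternal_submodule_iff_iSupIndep_and_iSup_eq_top]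
  constructor
  · intro i
    have hcop : IsCoprime (p i) (∏ j ∈ Finset.univ.erase i, p j) :=
      IsCoprime.prod_right fun j hj => hp (Finset.ne_of_mem_erase hj).symm
    refine (disjoint_ker_aeval_of_isCoprime f hcop).mono_right (iSup₂_le fun j hj => ?_)
    exact ker_aeval_le_of_dvd f
      (Finset.dvd_prod_of_mem p (Finset.mem_erase.2 ⟨hj, Finset.mem_univ j⟩))
  · have h := ker_aeval_prod_le_iSup hp Finset.univ (f := f)
    rw [hf, LinearMap.ker_zero] at h
    simpa using h

end PrimaryDecomposition

section SkewCentralizer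

variable {K V : Type*} [Field K] [AddCommGroup V] [Module K V]

/-- The operators that are skew-adjoint with respect to `B` and commute with `f`. -/
def skewCentralizer (B : BilinForm K V) (f : End K V) : Submodule K (End K V) :=
  B.skewAdjointSubmodule ⊓ LinearMap.ker (LinearMap.mulRight K f - LinearMap.mulLeft K f)

/-- The operator `w ↦ B u w • v + B v w • u` attached to a symmetric product of two vectors. For an
alternating form `B` it is skew-adjoint. -/
def symOperator (B : BilinForm K V) : V →ₗ[K] V →ₗ[K] End K V :=
  LinearMap.smulRightₗ.compl₁₂ B LinearMap.id + (LinearMap.smulRightₗ.compl₁₂ B LinearMap.id).flip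

variable {B : BilinForm K V} {f : End K V}

theorem mem_skewCentralizer {A : End K V} :
    A ∈ skewCentralizer B f ↔ B.IsSkewAdjoint A ∧ ∀ x, A (f x) = f (A x) := by
  rw [skewCentralizer, Submodule.mem_inf, LinearMap.mem_skewAdjointSubmodule, LinearMap.mem_ker]
  simp [sub_eq_zero, LinearMap.ext_iff]

theorem symOperator_apply (u v w : V) : symOperator B u v w = B u w • v + B v w • u := rfl

theorem isSkewAdjoint_symOperator (hB : B.IsAlt) (u v : V) :
    B.IsSkewAdjoint (symOperator B u v) := by
  rw [isSkewAdjoint_iff]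
  intro x y
  simp only [symOperator_apply, map_add, LinearMap.add_apply, map_smul, LinearMap.smul_apply,
    smul_eq_mul]
  rw [← hB.neg_eq u x, ← hB.neg_eq v x]
  ring

theorem symOperator_mem_skewCentralizer (hB : B.IsAlt) (hf : B.IsSkewAdjoint f) {a : K} {u v : V}
    (hu : u ∈ f.eigenspace a) (hv : v ∈ f.eigenspace (-a)) :
    symOperator B u v ∈ skewCentralizer B f := by
  rw [End.mem_eigenspace_iff] at hu hv
  refine mem_skewCentralizer.2 ⟨isSkewAdjoint_symOperator hB u v, fun w => ?_⟩
  have hBu : B u (f w) = -(a * B u w) := by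
    rw [← neg_eq_iff_eq_neg, ← isSkewAdjoint_iff.1 hf, hu, map_smul, LinearMap.smul_apply,
      smul_eq_mul]
  have hBv : B v (f w) = a * B v w := by
    rw [← neg_inj, ← isSkewAdjoint_iff.1 hf, hv, map_smul, LinearMap.smul_apply, smul_eq_mul,
      neg_mul]
  rw [symOperator_apply, symOperator_apply, hBu, hBv, map_add, map_smul, map_smul, hu, hv]
  module

theorem eq_zero_or_eq_zero_of_symOperator_eq_zero [NeZero (2 : K)] (hB : B.Nondegenerate)
    {u v : V} (h : symOperator B u v = 0) : u = 0 ∨ v = 0 := by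
  by_contra! ⟨hu, hv⟩
  obtain ⟨w, hw⟩ : ∃ w, B u w ≠ 0 := by
    by_contra! hcon
    exact hu (hB.1 _ hcon)
  have key : ∀ w, B u w • v + B v w • u = 0 := LinearMap.congr_fun h
  obtain ⟨c, rfl⟩ : ∃ c : K, v = c • u := by
    refine ⟨-(B u w)⁻¹ * B v w, ?_⟩
    rw [mul_smul, eq_neg_of_add_eq_zero_right (key w), neg_smul, smul_neg, neg_neg, smul_smul,
      inv_mul_cancel₀ hw, one_smul]
  have hc : c ≠ 0 := fun hc => hv (by rw [hc, zero_smul])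
  have h2 : (2 * (c * B u w)) • u = 0 := by
    rw [← key w, map_smul, LinearMap.smul_apply, smul_eq_mul]
    module
  exact (smul_ne_zero (mul_ne_zero two_ne_zero (mul_ne_zero hc hw)) hu) h2

theorem eq_zero_of_sum_symOperator_eq_zero {ι : Type*} [Fintype ι] (hB : B.Nondegenerate)
    {E F : Submodule K V} (hEF : Disjoint E F) {u : ι → E} {v : ι → F}
    (hv : LinearIndependent K v) (h : ∑ i, symOperator B (u i) (v i) = 0) : u = 0 := by
  have hsum : ∀ w, (∑ i, B (v i) w • (u i : V)) + ∑ i, B (u i) w • (v i : V) = 0 := fun w => by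
    have hw := LinearMap.congr_fun h w
    simpa [symOperator_apply, Finset.sum_add_distrib, add_comm] using hw
  have hmem : ∀ w, ∑ i, B (u i) w • (v i : V) ∈ E := fun w =>
    eq_neg_of_add_eq_zero_right (hsum w) ▸
      neg_mem (sum_mem fun i _ => Submodule.smul_mem _ _ (u i).2)
  have hB0 : ∀ w i, B (u i) w = 0 := fun w =>
    Fintype.linearIndependent_iff.1 (hv.map' _ (Submodule.ker_subtype _)) _
      (Submodule.disjoint_def.1 hEF _ (hmem w)
        (sum_mem fun i _ => Submodule.smul_mem _ _ (v i).2))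
  funext i
  exact Subtype.ext (hB.1 _ fun w => hB0 w i)

theorem finrank_eigenspace_mul_le [NeZero (2 : K)] [FiniteDimensional K V] (hB : B.Nondegenerate)
    (halt : B.IsAlt) (hf : B.IsSkewAdjoint f) {a : K} (ha : a ≠ 0) :
    finrank K (f.eigenspace (-a)) * finrank K (f.eigenspace a) ≤
      finrank K (skewCentralizer B f) := by
  let b := finBasis K (f.eigenspace (-a))
  let φ : (Fin (finrank K (f.eigenspace (-a))) → f.eigenspace a) →ₗ[K] End K V :=
    ∑ i, (symOperator B).flip (b i) ∘ₗ (f.eigenspace a).subtype ∘ₗ LinearMap.proj i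
  have hφ : ∀ u, φ u = ∑ i, symOperator B (u i) (b i) := fun u => by simp [φ]
  have hmem : ∀ u, φ u ∈ skewCentralizer B f := fun u => hφ u ▸
    sum_mem fun i _ => symOperator_mem_skewCentralizer halt hf (u i).2 (b i).2
  have hne : a ≠ -a := fun h => mul_ne_zero two_ne_zero ha (by
    rw [two_mul, ← eq_neg_iff_add_eq_zero, ← h])
  have hinj : Function.Injective (φ.codRestrict _ hmem) :=
    (injective_iff_map_eq_zero _).2 fun u hu => eq_zero_of_sum_symOperator_eq_zero hB
      (f.eigenspaces_iSupIndep.pairwiseDisjoint hne) b.linearIndependent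
      ((hφ u).symm.trans (congrArg Subtype.val hu))
  have h := LinearMap.finrank_le_finrank_of_injective hinj
  rwa [Module.finrank_pi_fintype, Finset.sum_const, Finset.card_univ, Fintype.card_fin,
    smul_eq_mul] at h

end SkewCentralizer

section BaseChange

variable {K L V : Type*} [Field K] [Field L] [Algebra K L] [AddCommGroup V] [Module K V]
  {B : BilinForm K V} {f : End K V}

/-- Contraction of the first factor of `L ⊗ V` with a `K`-linear functional on `L`. For `L = ℂ` and
`K = ℝ` the real and the imaginary part of a vector arise in this way. -/
def slice (φ : Dual K L) : L ⊗[K] V →ₗ[K] V := TensorProduct.lid K V ∘ₗ φ.rTensor V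

theorem slice_tmul (φ : Dual K L) (c : L) (x : V) : slice φ (c ⊗ₜ x) = φ c • x := by
  simp [slice]

theorem slice_baseChange (φ : Dual K L) (f : End K V) (u : L ⊗[K] V) :
    slice φ (f.baseChange L u) = f (slice φ u) := by
  induction u with
  | zero => simp only [map_zero]
  | tmul c x => simp [slice_tmul]
  | add u v hu hv => simp only [map_add, hu, hv]

theorem apply_slice_left (φ : Dual K L) (u : L ⊗[K] V) (y : V) :
    B (slice φ u) y = φ (B.baseChange L u (1 ⊗ₜ y)) := by
  induction u with
  | zero => simp
  | tmul c x => simp [slice_tmul, mul_comm]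
  | add u v hu hv => simp only [map_add, LinearMap.add_apply, hu, hv]

theorem apply_slice_right (φ : Dual K L) (x : V) (u : L ⊗[K] V) :
    B x (slice φ u) = φ (B.baseChange L (1 ⊗ₜ x) u) := by
  induction u with
  | zero => simp
  | tmul c y => simp [slice_tmul, mul_comm]
  | add u v hu hv => simp only [map_add, hu, hv]

theorem sum_tmul_slice_coord {ι : Type*} [Fintype ι] (b : Basis ι K L) (u : L ⊗[K] V) :
    ∑ i, b i ⊗ₜ slice (b.coord i) u = u := by
  induction u with
  | zero => simp
  | tmul c x =>
    simp only [slice_tmul, ← TensorProduct.smul_tmul, Basis.coord_apply]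
    rw [← TensorProduct.sum_tmul, b.sum_repr]
  | add u v hu hv =>
    simp only [map_add, TensorProduct.tmul_add, Finset.sum_add_distrib, hu, hv]

theorem eq_zero_of_slice_coord_eq_zero {ι : Type*} [Finite ι] (b : Basis ι K L) {u : L ⊗[K] V}
    (hu : ∀ i, slice (b.coord i) u = 0) : u = 0 := by
  have := Fintype.ofFinite ι
  rw [← sum_tmul_slice_coord b u]
  simp [hu]

theorem isSkewAdjoint_baseChange (hf : B.IsSkewAdjoint f) :
    (B.baseChange L).IsSkewAdjoint (f.baseChange L) := by
  rw [isSkewAdjoint_iff] at hf ⊢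
  intro u v
  induction u with
  | zero => simp
  | tmul c x =>
    induction v with
    | zero => simp
    | tmul d y => simp [hf]
    | add v w hv hw => rw [map_add, hv, hw, map_add, map_add, neg_add]
  | add u w hu hw => simp only [map_add, LinearMap.add_apply, hu, hw, neg_add]

theorem isAlt_baseChange [NeZero (2 : L)] (hB : B.IsAlt) : (B.baseChange L).IsAlt := by
  have hneg : ∀ u v, B.baseChange L u v = -B.baseChange L v u := fun u v => by
    induction u with
    | zero => simp
    | tmul c x =>
      induction v with
      | zero => simp
      | tmul d y => simp [← hB.neg_eq x y, mul_comm c d]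
      | add v w hv hw => simp only [map_add, LinearMap.add_apply, hv, hw, neg_add]
    | add u w hu hw => simp only [map_add, LinearMap.add_apply, hu, hw, neg_add]
  intro u
  have h := hneg u u
  rw [eq_neg_iff_add_eq_zero, ← two_mul] at h
  exact (mul_eq_zero.1 h).resolve_left two_ne_zero

theorem nondegenerate_baseChange [FiniteDimensional K L] (hB : B.Nondegenerate) :
    (B.baseChange L).Nondegenerate := by
  refine ⟨fun u hu => eq_zero_of_slice_coord_eq_zero (finBasis K L) fun i => hB.1 _ fun y => ?_,
    fun u hu => eq_zero_of_slice_coord_eq_zero (finBasis K L) fun i => hB.2 _ fun y => ?_⟩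
  · rw [apply_slice_left, hu, map_zero]
  · rw [apply_slice_right, hu, map_zero]

/-- The `K`-linear operator `x ↦ slice φ (A (1 ⊗ x))` extracted from an `L`-linear operator. -/
def sliceEnd (φ : Dual K L) : End L (L ⊗[K] V) →ₗ[K] End K V where
  toFun A := slice φ ∘ₗ A.restrictScalars K ∘ₗ TensorProduct.mk K L V 1
  map_add' A A' := by ext x; simp
  map_smul' c A := by ext x; simp

theorem sliceEnd_apply (φ : Dual K L) (A : End L (L ⊗[K] V)) (x : V) :
    sliceEnd φ A x = slice φ (A (1 ⊗ₜ x)) := rfl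

theorem sliceEnd_mem_skewCentralizer (φ : Dual K L) {A : End L (L ⊗[K] V)}
    (hA : A ∈ skewCentralizer (B.baseChange L) (f.baseChange L)) :
    sliceEnd φ A ∈ skewCentralizer B f := by
  rw [mem_skewCentralizer, isSkewAdjoint_iff] at hA ⊢
  refine ⟨fun x y => ?_, fun x => ?_⟩
  · rw [sliceEnd_apply, sliceEnd_apply, apply_slice_left, apply_slice_right, hA.1, map_neg]
  · rw [sliceEnd_apply, sliceEnd_apply, ← slice_baseChange, ← hA.2, LinearMap.baseChange_tmul]

theorem eq_zero_of_sliceEnd_coord_eq_zero {ι : Type*} [Finite ι] (b : Basis ι K L)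
    {A : End L (L ⊗[K] V)} (hA : ∀ i, sliceEnd (b.coord i) A = 0) : A = 0 := by
  refine TensorProduct.AlgebraTensorModule.curry_injective (LinearMap.ext_ring ?_)
  ext x
  exact eq_zero_of_slice_coord_eq_zero b fun i => LinearMap.congr_fun (hA i) x

theorem finrank_le_finrank_of_family [FiniteDimensional K L] [FiniteDimensional K V] {E : Type*}
    [AddCommGroup E] [Module K E] [Module L E] [IsScalarTower K L E]
    (φ : Fin (finrank K L) → E →ₗ[K] V) (hφ : ∀ x, (∀ i, φ i x = 0) → x = 0) :
    finrank L E ≤ finrank K V := by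
  have h := LinearMap.finrank_le_finrank_of_injective (f := LinearMap.pi φ)
    ((injective_iff_map_eq_zero _).2 fun x hx => hφ x fun i => congrFun hx i)
  rw [Module.finrank_pi_fintype, Finset.sum_const, Finset.card_univ, Fintype.card_fin,
    smul_eq_mul, ← Module.finrank_mul_finrank K L E] at h
  exact Nat.le_of_mul_le_mul_left h finrank_pos

theorem aeval_baseChange (p : K[X]) (f : End K V) :
    aeval (f.baseChange L) p = (aeval f p).baseChange L :=
  aeval_algHom_apply (End.baseChangeHom K L V) f p

theorem finrank_ker_le_finrank_ker_baseChange [FiniteDimensional K V] (f : End K V) :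
    finrank K (LinearMap.ker f) ≤ finrank L (LinearMap.ker (f.baseChange L)) := by
  have hle : LinearMap.range ((LinearMap.ker f).subtype.baseChange L) ≤
      LinearMap.ker (f.baseChange L) := by
    rw [LinearMap.range_le_ker_iff, ← LinearMap.baseChange_comp, LinearMap.comp_ker_subtype,
      LinearMap.baseChange_zero]
  have hinj : Function.Injective ((LinearMap.ker f).subtype.baseChange L) :=
    Module.Flat.lTensor_preserves_injective_linearMap _ (LinearMap.ker f).subtype_injective
  rw [← Module.finrank_baseChange (R := L), ← LinearMap.finrank_range_of_inj hinj]
  exact Submodule.finrank_mono hle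

theorem isNonderogatory_of_baseChange [FiniteDimensional K V]
    (hf : IsNonderogatory (f.baseChange L)) : IsNonderogatory f := fun p hp => by
  have h := hf (p.map (algebraMap K L)) (Polynomial.map_ne_zero hp)
  rw [natDegree_map, aeval_map_algebraMap, aeval_baseChange] at h
  exact (finrank_ker_le_finrank_ker_baseChange _).trans h

end BaseChange

section Complexification

variable {V : Type*} [AddCommGroup V] [Module ℝ V] [FiniteDimensional ℝ V] {B : BilinForm ℝ V}
  {f : End ℝ V}

theorem finrank_skewCentralizer_baseChange_le :
    finrank ℂ (skewCentralizer (B.baseChange ℂ) (f.baseChange ℂ)) ≤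
      finrank ℝ (skewCentralizer B f) := by
  let b := finBasis ℝ ℂ
  let Z := skewCentralizer (B.baseChange ℂ) (f.baseChange ℂ)
  refine finrank_le_finrank_of_family (E := Z) (fun i => LinearMap.codRestrict _
    (sliceEnd (b.coord i) ∘ₗ Z.subtype.restrictScalars ℝ)
    fun A => sliceEnd_mem_skewCentralizer _ A.2) fun A hA => Subtype.ext ?_
  exact eq_zero_of_sliceEnd_coord_eq_zero b fun i => congrArg Subtype.val (hA i)

end Complexification

section OddPolynomials

variable {K V : Type*} [Field K] [AddCommGroup V] [Module K V] {B : BilinForm K V} {f : End K V}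

theorem mul_aeval_sq_mem_skewCentralizer (hf : B.IsSkewAdjoint f) (q : K[X]) :
    f * aeval (f ^ 2) q ∈ skewCentralizer B f := by
  have hcomm : ∀ x, aeval (f ^ 2) q (f x) = f (aeval (f ^ 2) q x) := fun x => by
    have h := aeval_apply_comm f (q.comp (X ^ 2)) x
    rwa [aeval_comp, aeval_X_pow] at h
  have hf2 : LinearMap.IsAdjointPair B B (f ^ 2 : End K V) (f ^ 2 : End K V) := fun x y => by
    rw [pow_two, End.mul_apply, End.mul_apply, isSkewAdjoint_iff.1 hf, isSkewAdjoint_iff.1 hf,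
      neg_neg]
  refine mem_skewCentralizer.2 ⟨isSkewAdjoint_iff.2 fun x y => ?_, fun x => ?_⟩
  · rw [End.mul_apply, End.mul_apply, isSkewAdjoint_iff.1 hf, isAdjointPair_aeval hf2, hcomm]
  · rw [End.mul_apply, End.mul_apply, hcomm]

theorem exists_dvd_iff_aeval_X_mul_eq_zero [FiniteDimensional K V] (g : End K V) :
    ∃ p : K[X], p ≠ 0 ∧ ∀ q, p ∣ q ↔ aeval g (X * q) = 0 := by
  have hne : minpoly K g ≠ 0 := minpoly.ne_zero (Algebra.IsIntegral.isIntegral g)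
  by_cases hX : X ∣ minpoly K g
  · obtain ⟨p, hp⟩ := hX
    refine ⟨p, right_ne_zero_of_mul (hp ▸ hne), fun q => ?_⟩
    rw [← minpoly.dvd_iff, hp, mul_dvd_mul_iff_left X_ne_zero]
  · refine ⟨minpoly K g, hne, fun q => ?_⟩
    rw [← minpoly.dvd_iff]
    exact ⟨(Dvd.dvd.mul_left · X),
      (irreducible_X.coprime_iff_not_dvd.2 hX).symm.dvd_of_dvd_mul_left⟩

theorem aeval_sq_X_mul_eq_zero_of_add_symOperator_eq_zero {b u : V} (hb : b ∈ LinearMap.ker f)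
    (hu : u ∈ LinearMap.ker f) {q : K[X]} (h : f * aeval (f ^ 2) q + symOperator B b u = 0) :
    aeval (f ^ 2) (X * q) = 0 := by
  have hzero : f * symOperator B b u = 0 := by
    ext w
    simp [symOperator_apply, LinearMap.mem_ker.1 hb, LinearMap.mem_ker.1 hu]
  have hmul := congrArg (f * ·) h
  simpa only [mul_add, hzero, ← mul_assoc, ← pow_two, add_zero, mul_zero, map_mul, aeval_X]
    using hmul

theorem natDegree_add_finrank_ker_le [NeZero (2 : K)] [FiniteDimensional K V]
    (hB : B.Nondegenerate) (halt : B.IsAlt) (hf : B.IsSkewAdjoint f) {p : K[X]} (hp : p ≠ 0)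
    (h : ∀ q, aeval (f ^ 2) (X * q) = 0 → p ∣ q) :
    p.natDegree + finrank K (LinearMap.ker f) ≤ finrank K (skewCentralizer B f) := by
  -- Besides the odd polynomials in `f`, the skew centralizer contains the symmetric products of `b`
  -- with kernel vectors; these are independent of the former because `f` annihilates them.
  obtain ⟨b, hb, hb0⟩ : ∃ b ∈ LinearMap.ker f, b = 0 → LinearMap.ker f = ⊥ := by
    by_cases hker : LinearMap.ker f = ⊥
    · exact ⟨0, zero_mem _, fun _ => hker⟩
    · obtain ⟨b, hb, hb0⟩ := Submodule.exists_mem_ne_zero_of_ne_bot hker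
      exact ⟨b, hb, fun h0 => absurd h0 hb0⟩
  let φ : degreeLT K p.natDegree × LinearMap.ker f →ₗ[K] End K V :=
    LinearMap.coprod (LinearMap.mulLeft K f ∘ₗ (aeval (f ^ 2)).toLinearMap ∘ₗ Submodule.subtype _)
      (symOperator B b ∘ₗ Submodule.subtype _)
  have hφ : ∀ q u, φ (q, u) = f * aeval (f ^ 2) (q : K[X]) + symOperator B b u := fun _ _ => rfl
  have hmem : ∀ x, φ x ∈ skewCentralizer B f := fun ⟨q, u⟩ => by
    have hker : ∀ x ∈ LinearMap.ker f, x ∈ f.eigenspace 0 := fun x hx =>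
      End.mem_eigenspace_iff.2 ((LinearMap.mem_ker.1 hx).trans (zero_smul K x).symm)
    exact hφ q u ▸ add_mem (mul_aeval_sq_mem_skewCentralizer hf _)
      (symOperator_mem_skewCentralizer halt hf (hker b hb) (neg_zero (G := K).symm ▸ hker u u.2))
  have hinj : Function.Injective (φ.codRestrict _ hmem) := by
    refine (injective_iff_map_eq_zero _).2 fun ⟨q, u⟩ hqu => ?_
    have hsum : f * aeval (f ^ 2) (q : K[X]) + symOperator B b u = 0 := congrArg Subtype.val hqu
    have hq0 : (q : K[X]) = 0 :=
      eq_zero_of_dvd_of_degree_lt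
        (h q (aeval_sq_X_mul_eq_zero_of_add_symOperator_eq_zero hb u.2 hsum))
        (degree_eq_natDegree hp ▸ mem_degreeLT.1 q.2)
    rw [hq0, map_zero, mul_zero, zero_add] at hsum
    have hu0 : (u : V) = 0 := (eq_zero_or_eq_zero_of_symOperator_eq_zero hB hsum).elim
      (fun h0 => (Submodule.eq_bot_iff _).1 (hb0 h0) u u.2) id
    exact Prod.ext (Subtype.ext hq0) (Subtype.ext hu0)
  have hrank := LinearMap.finrank_le_finrank_of_injective hinj
  rwa [Module.finrank_prod, (degreeLTEquiv K p.natDegree).finrank_eq, Module.finrank_fin_fun]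
    at hrank

end OddPolynomials

namespace LinearHamiltonianSystem

section Quadruplets

theorem mem_quadruplet_self (z : ℂ) : z ∈ quadruplet z := Or.inl rfl

/-- The minimal polynomial over `ℝ` of the square of `z`. Its roots are the squares of the elements
of the quadruplet of `z`. -/
def sqPoly (z : ℂ) : ℝ[X] := minpoly ℝ (z ^ 2)

theorem sqPoly_monic (z : ℂ) : (sqPoly z).Monic := minpoly.monic (IsIntegral.of_finite ℝ _)

theorem sqPoly_irreducible (z : ℂ) : Irreducible (sqPoly z) :=
  minpoly.irreducible (IsIntegral.of_finite ℝ _)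

theorem aeval_quadratic (z u : ℂ) :
    aeval u (X ^ 2 - C (2 * z.re) * X + C (Complex.normSq z) : ℝ[X]) =
      (u - z) * (u - (starRingEnd ℂ) z) := by
  rw [map_add, map_sub, map_mul, map_pow, aeval_X, aeval_C, aeval_C, Complex.coe_algebraMap,
    ← Complex.mul_conj, ← Complex.add_conj]
  ring

theorem aeval_sqPoly_eq_zero_iff {z w : ℂ} :
    aeval (w ^ 2) (sqPoly z) = 0 ↔ w ∈ quadruplet z := by
  have hself : ∀ z : ℂ, aeval (z ^ 2) (sqPoly z) = 0 := fun z => minpoly.aeval ℝ (z ^ 2)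
  constructor
  · intro h
    have hdvd : sqPoly z ∣ X ^ 2 - C (2 * (z ^ 2).re) * X + C (Complex.normSq (z ^ 2)) :=
      minpoly.dvd _ _ (by rw [aeval_quadratic, sub_self, zero_mul])
    have hroot := aeval_eq_zero_of_dvd_aeval_eq_zero hdvd h
    rw [aeval_quadratic, mul_eq_zero, sub_eq_zero, sub_eq_zero, map_pow, sq_eq_sq_iff_eq_or_eq_neg,
      sq_eq_sq_iff_eq_or_eq_neg, or_assoc] at hroot
    exact hroot
  · rintro (rfl | rfl | rfl | rfl)
    · exact hself _
    · rw [neg_sq, hself]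
    · rw [← map_pow, aeval_conj, hself, map_zero]
    · rw [neg_sq, ← map_pow, aeval_conj, hself, map_zero]

theorem quadruplet_eq_of_sqPoly_eq {z w : ℂ} (h : sqPoly z = sqPoly w) :
    quadruplet z = quadruplet w := by
  ext u
  rw [← aeval_sqPoly_eq_zero_iff, ← aeval_sqPoly_eq_zero_iff, h]

theorem isCoprime_sqPoly {z w : ℂ} (h : quadruplet z ≠ quadruplet w) :
    IsCoprime (sqPoly z) (sqPoly w) :=
  isCoprime_of_irreducible_of_monic_of_ne (sqPoly_irreducible z) (sqPoly_irreducible w)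
    (sqPoly_monic z) (sqPoly_monic w) fun heq => h (quadruplet_eq_of_sqPoly_eq heq)

theorem natDegree_sqPoly_pos (z : ℂ) : 0 < (sqPoly z).natDegree :=
  minpoly.natDegree_pos (IsIntegral.of_finite ℝ _)

theorem natDegree_sqPoly_le (z : ℂ) : (sqPoly z).natDegree ≤ 2 :=
  (minpoly.natDegree_le (z ^ 2)).trans_eq Complex.finrank_real_complex

theorem natDegree_sqPoly_eq_one_iff {z : ℂ} :
    (sqPoly z).natDegree = 1 ↔ z.re = 0 ∨ z.im = 0 := by
  rw [sqPoly, minpoly.natDegree_eq_one_iff, ← mul_eq_zero]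
  constructor
  · rintro ⟨c, hc⟩
    have him := congrArg Complex.im hc
    simp only [Complex.coe_algebraMap, Complex.ofReal_im, pow_two, Complex.mul_im] at him
    linarith
  · exact fun h => ⟨(z ^ 2).re, Complex.ext rfl (by
      simp only [Complex.coe_algebraMap, Complex.ofReal_im, pow_two, Complex.mul_im]; linarith)⟩

/-- The monic real polynomial whose roots are the elements of the quadruplet of `z`. -/
def quadrupletPoly (z : ℂ) : ℝ[X] := (sqPoly z).comp (X ^ 2)

theorem quadrupletPoly_monic (z : ℂ) : (quadrupletPoly z).Monic :=
  (sqPoly_monic z).comp (monic_X_pow 2) (by simp)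

theorem natDegree_quadrupletPoly (z : ℂ) :
    (quadrupletPoly z).natDegree = 2 * (sqPoly z).natDegree := by
  rw [quadrupletPoly, natDegree_comp, natDegree_X_pow, mul_comm]

theorem quadrupletPoly_comp_neg_X (z : ℂ) : (quadrupletPoly z).comp (-X) = quadrupletPoly z := by
  rw [quadrupletPoly, comp_assoc, X_pow_comp, neg_sq]

theorem aeval_quadrupletPoly_eq_zero_iff {z w : ℂ} :
    aeval w (quadrupletPoly z) = 0 ↔ w ∈ quadruplet z := by
  rw [quadrupletPoly, aeval_comp, aeval_X_pow, aeval_sqPoly_eq_zero_iff]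

theorem isCoprime_quadrupletPoly {z w : ℂ} (h : quadruplet z ≠ quadruplet w) :
    IsCoprime (quadrupletPoly z) (quadrupletPoly w) :=
  (isCoprime_sqPoly h).map (compRingHom (X ^ 2))

end Quadruplets

variable {V : Type*} [AddCommGroup V] [Module ℝ V] [FiniteDimensional ℝ V]
  (S : LinearHamiltonianSystem V)

theorem isSkewAdjoint_vectorField : S.ω.IsSkewAdjoint S.vectorField :=
  (LinearMap.mem_skewAdjointSubmodule _).1 S.vectorField_mem

theorem even_finrank (S : LinearHamiltonianSystem V) : Even (finrank ℝ V) :=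
  even_finrank_of_isAlt S.isAlt S.nondegenerate

section Eigenvalues

theorem mem_eigenvalues_iff_finrank {z : ℂ} :
    z ∈ S.eigenvalues ↔ 0 < finrank ℂ (S.complexVectorField.eigenspace z) := by
  rw [Nat.pos_iff_ne_zero, Ne, Submodule.finrank_eq_zero]
  exact Iff.rfl

theorem mem_eigenvalues_iff_aeval_charpoly {z : ℂ} :
    z ∈ S.eigenvalues ↔ aeval z S.vectorField.charpoly = 0 := by
  rw [eigenvalues, Set.mem_ofPred_eq, End.hasEigenvalue_iff_isRoot_charpoly, complexVectorField,
    LinearMap.charpoly_baseChange, IsRoot, eval_map_algebraMap]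

theorem aeval_eq_zero_of_mem_eigenvalues {z : ℂ} (hz : z ∈ S.eigenvalues) {p : ℝ[X]}
    (hp : aeval S.vectorField p = 0) : aeval z p = 0 := by
  obtain ⟨x, hx⟩ := End.HasEigenvalue.exists_hasEigenvector hz
  have h := End.aeval_apply_of_hasEigenvector (p := p.map (algebraMap ℝ ℂ)) hx
  rw [aeval_map_algebraMap, complexVectorField, aeval_baseChange, hp, LinearMap.baseChange_zero,
    LinearMap.zero_apply, eval_map_algebraMap] at h
  exact (smul_eq_zero.1 h.symm).resolve_right hx.2

theorem ker_vectorField_eq_bot_iff : LinearMap.ker S.vectorField = ⊥ ↔ (0 : ℂ) ∉ S.eigenvalues := by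
  have h : (0 : ℂ) ∈ S.eigenvalues ↔ S.vectorField.HasEigenvalue 0 := by
    rw [mem_eigenvalues_iff_aeval_charpoly, End.hasEigenvalue_iff_isRoot_charpoly, IsRoot,
      ← map_zero (algebraMap ℝ ℂ), aeval_algebraMap_apply, coe_aeval_eq_eval,
      (algebraMap ℝ ℂ).injective.eq_iff]
  rw [h, End.hasEigenvalue_iff, End.eigenspace_zero, not_ne_iff]

end Eigenvalues

section Codimension

/-- The Lie algebra of the stabilizer of the vector field in the symplectic group: its dimension is
the codimension of `orbitTangentSpace` in `sp(V, ω)`. -/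
abbrev centralizer : Submodule ℝ (End ℝ V) := skewCentralizer S.ω S.vectorField

theorem codimension_eq :
    S.codimension = (finrank ℝ S.centralizer : ℤ) - S.moduliNumber := by
  have h := finrank_map_add_finrank_inf_ker
    (LinearMap.mulRight ℝ S.vectorField - LinearMap.mulLeft ℝ S.vectorField)
    S.hamiltonianOperators
  rw [codimension, orbitTangentSpace, centralizer, skewCentralizer]
  rw [hamiltonianOperators] at h ⊢
  omega

theorem moduliNumber_le_natDegree {p : ℝ[X]} (hp : p ≠ 0)
    (h : ∀ z ∈ S.eigenvalues, z ≠ 0 → aeval (z ^ 2) p = 0) : S.moduliNumber ≤ p.natDegree := by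
  calc S.moduliNumber ≤ ((p.aroots ℂ).toFinset : Set ℂ).ncard := by
        refine Set.ncard_le_ncard_of_injOn (· ^ 2) ?_ ?_ (Finset.finite_toSet _)
        · rintro z ⟨hz, hpos⟩
          have hz0 : z ≠ 0 := by rintro rfl; simp at hpos
          exact Multiset.mem_toFinset.2 (mem_aroots.2 ⟨hp, h z hz hz0⟩)
        · rintro w ⟨-, hw⟩ v ⟨-, hv⟩ hwv
          refine (sq_eq_sq_iff_eq_or_eq_neg.1 hwv).resolve_right ?_
          rintro rfl
          simp only [Complex.neg_re, Complex.neg_im] at hw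
          rcases hw with hw | hw <;> rcases hv with hv | hv <;> linarith
    _ ≤ p.natDegree := by
        rw [Set.ncard_coe_finset]
        exact (Multiset.toFinset_card_le _).trans (card_roots_map_le_natDegree p)

theorem finrank_ker_vectorField_le_codimension :
    (finrank ℝ (LinearMap.ker S.vectorField) : ℤ) ≤ S.codimension := by
  obtain ⟨p, hp, hdvd⟩ := exists_dvd_iff_aeval_X_mul_eq_zero (S.vectorField ^ 2)
  have hC : p.natDegree + finrank ℝ (LinearMap.ker S.vectorField) ≤ finrank ℝ S.centralizer :=
    natDegree_add_finrank_ker_le S.nondegenerate S.isAlt S.isSkewAdjoint_vectorField hp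
      fun q => (hdvd q).2
  have hm : S.moduliNumber ≤ p.natDegree := S.moduliNumber_le_natDegree hp fun z hz hz0 => by
    have h := S.aeval_eq_zero_of_mem_eigenvalues hz (p := (X * p).comp (X ^ 2)) (by
      rw [aeval_comp, aeval_X_pow, (hdvd p).1 dvd_rfl])
    rw [aeval_comp, aeval_X_pow, map_mul, aeval_X] at h
    exact (mul_eq_zero.1 h).resolve_left (pow_ne_zero 2 hz0)
  rw [codimension_eq]
  omega

theorem finrank_le_two_mul_finrank_centralizer (hker : LinearMap.ker S.vectorField = ⊥)
    (hL : IsNonderogatory S.vectorField) :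
    finrank ℝ V ≤ 2 * finrank ℝ S.centralizer := by
  obtain ⟨p, hp, hdvd⟩ := exists_dvd_iff_aeval_X_mul_eq_zero (S.vectorField ^ 2)
  have hC : p.natDegree + finrank ℝ (LinearMap.ker S.vectorField) ≤ finrank ℝ S.centralizer :=
    natDegree_add_finrank_ker_le S.nondegenerate S.isAlt S.isSkewAdjoint_vectorField hp
      fun q => (hdvd q).2
  have htop : LinearMap.ker (aeval S.vectorField (p.comp (X ^ 2))) = ⊤ := by
    have h := (hdvd p).1 dvd_rfl
    rw [map_mul, aeval_X, pow_two, mul_assoc] at h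
    have hinj := LinearMap.ker_eq_bot.1 hker
    rw [aeval_comp, aeval_X_pow, LinearMap.ker_eq_top]
    ext x
    exact hinj (hinj ((LinearMap.congr_fun h x).trans (by simp)))
  have hp2 : p.comp (X ^ 2) ≠ 0 := by
    rwa [← expand_eq_comp_X_pow, Ne, expand_eq_zero two_pos]
  have hle := hL _ hp2
  rw [htop, finrank_top, natDegree_comp, natDegree_X_pow] at hle
  omega

theorem radical_eq_ker : S.H.radical = LinearMap.ker S.vectorField := by
  rw [QuadraticMap.radical_eq_ker_associated]
  ext y
  have h : ∀ x, S.ω x (S.vectorField y) = QuadraticMap.associated (R := ℝ) S.H y x := fun x => by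
    rw [ω_vectorField]
    exact QuadraticMap.associated_isSymm ℝ S.H x y
  simp only [LinearMap.mem_ker, LinearMap.ext_iff, ← h, LinearMap.zero_apply]
  exact ⟨fun hy => S.nondegenerate.2 _ hy, fun hy x => by rw [hy, map_zero]⟩

theorem even_finrank_ker_vectorField (hsig : Even S.signature) :
    Even (finrank ℝ (LinearMap.ker S.vectorField)) := by
  have hsum := QuadraticForm.sigPos_add_sigNeg_add_radical (Q := S.H)
  rw [radical_eq_ker] at hsum
  have heven := S.even_finrank
  rw [signature] at hsig
  grind

theorem ker_vectorField_eq_bot (hsig : Even S.signature) (hcodim : S.codimension ≤ 1) :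
    LinearMap.ker S.vectorField = ⊥ := by
  obtain ⟨n, hn⟩ := S.even_finrank_ker_vectorField hsig
  have hle := S.finrank_ker_vectorField_le_codimension
  exact Submodule.finrank_eq_zero.1 (by omega)

end Codimension

theorem finite_eigenvalues : S.eigenvalues.Finite :=
  End.finite_hasEigenvalue S.complexVectorField

namespace Splitting

variable {S} {r : ℕ} (D : S.Splitting r)

/-- The projection of a split system to a component. -/
def proj (j : Fin r) : V →ₗ[ℝ] D.comp j :=
  DirectSum.component ℝ (Fin r) (fun j => D.comp j) j ∘ₗ
    (LinearEquiv.ofBijective (DirectSum.coeLinearMap D.comp) D.isInternal).symm.toLinearMap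

theorem proj_coe (j : Fin r) (x : D.comp j) : D.proj j x = x :=
  D.isInternal.ofBijective_coeLinearMap_same x

theorem proj_coe_of_ne {i j : Fin r} (hij : i ≠ j) (x : D.comp j) : D.proj i x = 0 :=
  D.isInternal.ofBijective_coeLinearMap_of_ne hij.symm x

theorem proj_sum_coe (x : ∀ j, D.comp j) (i : Fin r) : D.proj i (∑ j, (x j : V)) = x i := by
  rw [map_sum, Finset.sum_eq_single i (fun j _ hj => D.proj_coe_of_ne hj.symm _) (by simp),
    proj_coe]

theorem sum_proj (x : V) : ∑ j, (D.proj j x : V) = x := by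
  obtain ⟨y, rfl⟩ := D.isInternal.2 x
  have hy : DirectSum.coeAddMonoidHom D.comp y = ∑ j, (y j : V) := by
    conv_lhs => rw [← DirectSum.sum_univ_of y, map_sum]
    simp only [DirectSum.coeAddMonoidHom_of]
  rw [hy]
  exact Finset.sum_congr rfl fun j _ => congrArg Subtype.val (D.proj_sum_coe (fun j => y j) j)

theorem ω_coe_right (j : Fin r) (x : V) (y : D.comp j) :
    S.ω x y = (D.subsystem j).ω (D.proj j x) y := by
  conv_lhs => rw [← D.sum_proj x, map_sum, LinearMap.sum_apply]
  exact Finset.sum_eq_single j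
    (fun i _ hi => D.ω_eq_zero i j hi _ (D.proj i x).2 _ y.2) (by simp)

theorem ω_eq_sum (x y : V) :
    S.ω x y = ∑ j, (D.subsystem j).ω (D.proj j x) (D.proj j y) := by
  conv_lhs => rw [← D.sum_proj y, map_sum]
  exact Finset.sum_congr rfl fun j _ => D.ω_coe_right j x _

theorem associated_coe_right (j : Fin r) (x : V) (y : D.comp j) :
    QuadraticMap.associated (R := ℝ) S.H x y =
      QuadraticMap.associated (R := ℝ) (D.subsystem j).H (D.proj j x) y := by
  conv_lhs => rw [← D.sum_proj x, map_sum, LinearMap.sum_apply]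
  rw [Finset.sum_eq_single j (fun i _ hi => QuadraticMap.associated_isOrtho.2
    (D.H_add i j hi _ (D.proj i x).2 _ y.2)) (by simp)]
  exact (LinearMap.congr_fun₂ (QuadraticMap.associated_comp ℝ S.H (D.comp j).subtype)
    (D.proj j x) y).symm

theorem vectorField_coe (j : Fin r) (y : D.comp j) :
    S.vectorField y = (D.subsystem j).vectorField y := by
  refine sub_eq_zero.1 (S.nondegenerate.2 _ fun x => ?_)
  rw [map_sub, ω_vectorField, ω_coe_right, associated_coe_right, ω_vectorField, sub_self]

theorem proj_vectorField (j : Fin r) (x : V) :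
    D.proj j (S.vectorField x) = (D.subsystem j).vectorField (D.proj j x) := by
  conv_lhs => rw [← D.sum_proj x, map_sum]
  simp_rw [vectorField_coe]
  exact D.proj_sum_coe (fun i => (D.subsystem i).vectorField (D.proj i x)) j

theorem aeval_coe (p : ℝ[X]) (j : Fin r) (y : D.comp j) :
    aeval S.vectorField p (y : V) = aeval (D.subsystem j).vectorField p y :=
  aeval_apply_of_intertwine (i := (D.comp j).subtype) (D.vectorField_coe j) p y

theorem aeval_prod_charpoly_eq_zero :
    aeval S.vectorField (∏ j, (D.subsystem j).vectorField.charpoly) = 0 := by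
  ext x
  rw [← D.sum_proj x, map_sum, LinearMap.zero_apply]
  refine Finset.sum_eq_zero fun j _ => ?_
  rw [aeval_coe, ← Finset.prod_erase_mul _ _ (Finset.mem_univ j), map_mul, End.mul_apply,
    LinearMap.aeval_self_charpoly, LinearMap.zero_apply, map_zero, ZeroMemClass.coe_zero]

theorem eigenvalues_subset : S.eigenvalues ⊆ ⋃ j, (D.subsystem j).eigenvalues := fun z hz => by
  have h := S.aeval_eq_zero_of_mem_eigenvalues hz D.aeval_prod_charpoly_eq_zero
  rw [map_prod, Finset.prod_eq_zero_iff] at h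
  obtain ⟨j, -, hj⟩ := h
  exact Set.mem_iUnion.2 ⟨j, (D.subsystem j).mem_eigenvalues_iff_aeval_charpoly.2 hj⟩

theorem moduliNumber_le_sum : S.moduliNumber ≤ ∑ j, (D.subsystem j).moduliNumber := by
  have hfin : ∀ j, {z ∈ (D.subsystem j).eigenvalues | 0 < z.re ∨ (z.re = 0 ∧ 0 < z.im)}.Finite :=
    fun j => (D.subsystem j).finite_eigenvalues.sep _
  calc S.moduliNumber ≤ (⋃ j, {z ∈ (D.subsystem j).eigenvalues |
        0 < z.re ∨ (z.re = 0 ∧ 0 < z.im)}).ncard :=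
        Set.ncard_le_ncard (fun z ⟨hz, hpos⟩ =>
          let ⟨j, hj⟩ := Set.mem_iUnion.1 (D.eigenvalues_subset hz)
          Set.mem_iUnion.2 ⟨j, hj, hpos⟩) (Set.finite_iUnion hfin)
    _ ≤ ∑ j, (D.subsystem j).moduliNumber := Set.ncard_iUnion_le_of_fintype _

/-- The embedding of families of operators on the components as block diagonal operators. -/
def blockDiagonal : (∀ j, End ℝ (D.comp j)) →ₗ[ℝ] End ℝ V :=
  ∑ j, LinearMap.lcomp ℝ V (D.proj j) ∘ₗ LinearMap.compRight ℝ (D.comp j).subtype ∘ₗ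
    LinearMap.proj j

theorem blockDiagonal_apply (A : ∀ j, End ℝ (D.comp j)) (x : V) :
    D.blockDiagonal A x = ∑ j, (A j (D.proj j x) : V) := by
  simp [blockDiagonal, LinearMap.sum_apply]

theorem proj_blockDiagonal (A : ∀ j, End ℝ (D.comp j)) (x : V) (j : Fin r) :
    D.proj j (D.blockDiagonal A x) = A j (D.proj j x) := by
  rw [blockDiagonal_apply]
  exact D.proj_sum_coe (fun i => A i (D.proj i x)) j

theorem blockDiagonal_injective : Function.Injective D.blockDiagonal := fun A A' h => by
  funext j
  ext y
  have hy := D.proj_blockDiagonal A y j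
  rw [h, proj_blockDiagonal, proj_coe] at hy
  rw [hy]

theorem blockDiagonal_mem_centralizer {A : ∀ j, End ℝ (D.comp j)}
    (hA : ∀ j, A j ∈ (D.subsystem j).centralizer) : D.blockDiagonal A ∈ S.centralizer := by
  have hA' := fun j => mem_skewCentralizer.1 (hA j)
  refine mem_skewCentralizer.2 ⟨isSkewAdjoint_iff.2 fun x y => ?_, fun x => ?_⟩
  · rw [D.ω_eq_sum, D.ω_eq_sum, ← Finset.sum_neg_distrib]
    refine Finset.sum_congr rfl fun j _ => ?_
    rw [proj_blockDiagonal, proj_blockDiagonal, isSkewAdjoint_iff.1 (hA' j).1]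
  · rw [blockDiagonal_apply, blockDiagonal_apply, map_sum]
    refine Finset.sum_congr rfl fun j _ => ?_
    rw [proj_vectorField, (hA' j).2, vectorField_coe]

theorem sum_finrank_centralizer_le :
    ∑ j, finrank ℝ (D.subsystem j).centralizer ≤ finrank ℝ S.centralizer := by
  let φ : (∀ j, (D.subsystem j).centralizer) →ₗ[ℝ] S.centralizer :=
    LinearMap.codRestrict _
      (D.blockDiagonal ∘ₗ LinearMap.pi fun j => (Submodule.subtype _) ∘ₗ LinearMap.proj j)
      fun A => D.blockDiagonal_mem_centralizer fun j => (A j).2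
  have hφ : Function.Injective φ := fun A A' h => by
    have h' := D.blockDiagonal_injective (congrArg Subtype.val h)
    funext j
    exact Subtype.ext (congrFun h' j)
  rw [← Module.finrank_pi_fintype]
  exact LinearMap.finrank_le_finrank_of_injective hφ

theorem sum_codimension_le : ∑ j, (D.subsystem j).codimension ≤ S.codimension := by
  have hC := D.sum_finrank_centralizer_le
  have hm := D.moduliNumber_le_sum
  simp only [codimension_eq, Finset.sum_sub_distrib, ← Nat.cast_sum]
  omega

theorem codimension_subsystem_le (j : Fin r) : (D.subsystem j).codimension ≤ S.codimension :=
  (Finset.single_le_sum (f := fun j => (D.subsystem j).codimension)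
    (fun i _ => (Nat.cast_nonneg _).trans
      (D.subsystem i).finrank_ker_vectorField_le_codimension)
    (Finset.mem_univ j)).trans D.sum_codimension_le

theorem ker_vectorField_subsystem_eq_bot (h : LinearMap.ker S.vectorField = ⊥) (j : Fin r) :
    LinearMap.ker (D.subsystem j).vectorField = ⊥ := by
  refine LinearMap.ker_eq_bot'.2 fun y hy => Subtype.ext ?_
  refine LinearMap.ker_eq_bot'.1 h y ?_
  rw [vectorField_coe, hy, ZeroMemClass.coe_zero]

end Splitting

theorem charpoly_vectorField_comp_neg_X :
    S.vectorField.charpoly.comp (-X) = S.vectorField.charpoly := by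
  rw [charpoly_comp_neg_X_of_isSkewAdjoint S.nondegenerate S.isSkewAdjoint_vectorField,
    S.even_finrank.neg_one_pow, one_mul]

theorem exists_charpoly_eq_quadrupletPoly_pow {z : ℂ} (hS : S.eigenvalues ⊆ quadruplet z) :
    ∃ k, S.vectorField.charpoly = quadrupletPoly z ^ k := by
  obtain ⟨g, hg⟩ := exists_comp_X_sq_eq_of_comp_neg_X_eq S.charpoly_vectorField_comp_neg_X
  have hmonic : g.Monic := by
    have h := S.vectorField.charpoly_monic
    rwa [← hg, ← expand_eq_comp_X_pow, monic_expand_iff two_pos] at h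
  have hroot : ∀ a : ℂ, aeval a g = 0 → aeval a (sqPoly z) = 0 := fun a ha => by
    obtain ⟨w, rfl⟩ := IsAlgClosed.exists_pow_nat_eq a two_pos
    refine aeval_sqPoly_eq_zero_iff.2 (hS (S.mem_eigenvalues_iff_aeval_charpoly.2 ?_))
    rw [← hg, aeval_comp, aeval_X_pow, ha]
  obtain ⟨k, -, hk⟩ := (dvd_prime_pow (sqPoly_irreducible z).prime _).1
    (dvd_pow_natDegree_of_aeval_eq_zero ℂ hmonic.ne_zero hroot)
  refine ⟨k, ?_⟩
  rw [← hg, eq_of_monic_of_associated hmonic ((sqPoly_monic z).pow k) hk, quadrupletPoly, pow_comp]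

section NullLagrangians

/-- The Lagrangian subspaces contained in the null-cone. -/
def nullLagrangians : Set (Submodule ℝ V) := {W | S.IsLagrangian W ∧ (W : Set V) ⊆ S.nullCone}

variable {S}

theorem isLagrangian_iff {W : Submodule ℝ V} :
    S.IsLagrangian W ↔
      (∀ x ∈ W, ∀ y ∈ W, S.ω x y = 0) ∧ 2 * finrank ℝ W = finrank ℝ V := by
  have hfin := LinearMap.BilinForm.finrank_orthogonal S.nondegenerate W
  have hle := Submodule.finrank_le W
  refine ⟨fun h => ⟨fun x hx y hy => ?_, ?_⟩, fun ⟨hiso, hrank⟩ => ?_⟩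
  · rw [← h] at hy
    exact LinearMap.BilinForm.mem_orthogonal_iff.1 hy x hx
  · rw [h] at hfin
    omega
  · have hfin : finrank ℝ W = finrank ℝ (S.ω.orthogonal W) := by rw [hfin, ← hrank]; omega
    refine (Submodule.eq_of_le_of_finrank_eq (fun y hy => ?_) hfin).symm
    exact LinearMap.BilinForm.mem_orthogonal_iff.2 fun x hx => hiso x hx y hy

theorem mem_nullLagrangians_iff {W : Submodule ℝ V} :
    W ∈ S.nullLagrangians ↔ S.IsLagrangian W ∧ W ∈ S.vectorField.invtSubmodule := by
  refine and_congr_right fun hL => ⟨fun hH x hx => ?_, fun hinv x hx => ?_⟩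
  · rw [Submodule.mem_comap, ← hL]
    refine LinearMap.BilinForm.mem_orthogonal_iff.2 fun y hy => ?_
    have hnull : ∀ x ∈ W, S.H x = 0 := hH
    rw [ω_vectorField]
    refine QuadraticMap.associated_isOrtho.2 ?_
    rw [QuadraticMap.isOrtho_def, hnull _ (W.add_mem hy hx), hnull y hy, hnull x hx, add_zero]
  · change S.H x = 0
    rw [← QuadraticMap.associated_eq_self_apply ℝ S.H, ← ω_vectorField]
    exact (isLagrangian_iff.1 hL).1 x hx _ (hinv hx)

namespace Splitting

variable {r : ℕ} (D : S.Splitting r)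

theorem isCoprime_charpoly {i j : Fin r} (hij : i ≠ j) :
    IsCoprime (D.subsystem i).vectorField.charpoly (D.subsystem j).vectorField.charpoly := by
  obtain ⟨k, hk⟩ := (D.subsystem i).exists_charpoly_eq_quadrupletPoly_pow (D.eigenvalues_eq i).le
  obtain ⟨l, hl⟩ := (D.subsystem j).exists_charpoly_eq_quadrupletPoly_pow (D.eigenvalues_eq j).le
  rw [hk, hl]
  exact (isCoprime_quadrupletPoly (D.distinct i j hij)).pow

theorem exists_aeval_eq_proj (j : Fin r) :
    ∃ p : ℝ[X], ∀ x, aeval S.vectorField p x = (D.proj j x : V) := by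
  let P : Fin r → ℝ[X] := fun i => (D.subsystem i).vectorField.charpoly
  have hzero : ∀ i (y : D.comp i), aeval S.vectorField (P i) (y : V) = 0 := fun i y => by
    rw [aeval_coe, LinearMap.aeval_self_charpoly, LinearMap.zero_apply, ZeroMemClass.coe_zero]
  obtain ⟨a, b, hab⟩ : IsCoprime (∏ i ∈ Finset.univ.erase j, P i) (P j) :=
    IsCoprime.prod_left fun i hi => D.isCoprime_charpoly (Finset.ne_of_mem_erase hi)
  refine ⟨a * ∏ i ∈ Finset.univ.erase j, P i, fun x => ?_⟩
  conv_lhs => rw [← D.sum_proj x, map_sum]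
  rw [Finset.sum_eq_single j (fun i _ hi => ?_) (by simp)]
  · have h := LinearMap.congr_fun (congrArg (aeval S.vectorField) hab) (D.proj j x : V)
    rwa [map_add, map_mul _ b, LinearMap.add_apply, End.mul_apply, hzero, map_zero, add_zero,
      map_one, End.one_apply] at h
  · rw [← Finset.prod_erase_mul _ _ (Finset.mem_erase.2 ⟨hi, Finset.mem_univ i⟩), ← mul_assoc,
      map_mul, End.mul_apply, hzero, map_zero]

theorem proj_mem_of_mem_invtSubmodule {W : Submodule ℝ V} (hW : W ∈ S.vectorField.invtSubmodule)
    {x : V} (hx : x ∈ W) (j : Fin r) : (D.proj j x : V) ∈ W := by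
  obtain ⟨p, hp⟩ := D.exists_aeval_eq_proj j
  rw [← hp]
  exact aeval_apply_mem hW p hx

theorem mem_iff_forall_proj_mem {W : Submodule ℝ V} (hW : W ∈ S.vectorField.invtSubmodule)
    {x : V} : x ∈ W ↔ ∀ j, (D.proj j x : V) ∈ W :=
  ⟨fun hx j => D.proj_mem_of_mem_invtSubmodule hW hx j,
    fun h => D.sum_proj x ▸ W.sum_mem fun j _ => h j⟩

theorem comap_mem_nullLagrangians {W : Submodule ℝ V} (hW : W ∈ S.nullLagrangians) (j : Fin r) :
    W.comap (D.comp j).subtype ∈ (D.subsystem j).nullLagrangians := by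
  rw [mem_nullLagrangians_iff] at hW ⊢
  obtain ⟨hL, hinv⟩ := hW
  refine ⟨?_, fun y hy => ?_⟩
  · ext y
    have hy : (y : V) ∈ W ↔ ∀ x ∈ W, S.ω x y = 0 := by
      conv_lhs => rw [← hL]
      exact LinearMap.BilinForm.mem_orthogonal_iff
    rw [Submodule.mem_comap, Submodule.subtype_apply, hy]
    refine ⟨fun h x hx => ?_, fun h x hx => h x hx⟩
    rw [D.ω_coe_right]
    exact h _ (D.proj_mem_of_mem_invtSubmodule hinv hx j)
  · rw [Submodule.mem_comap, Submodule.mem_comap, Submodule.subtype_apply, ← vectorField_coe]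
    exact hinv hy

theorem forall_proj_coe_mem_iff {W : ∀ j, Submodule ℝ (D.comp j)} {j : Fin r} {y : D.comp j} :
    (∀ i, D.proj i y ∈ W i) ↔ y ∈ W j := by
  refine ⟨fun h => D.proj_coe j y ▸ h j, fun hy i => ?_⟩
  obtain rfl | hij := eq_or_ne i j
  · rwa [proj_coe]
  · rw [D.proj_coe_of_ne hij]
    exact zero_mem _

theorem iInf_mem_nullLagrangians {W : ∀ j, Submodule ℝ (D.comp j)}
    (hW : ∀ j, W j ∈ (D.subsystem j).nullLagrangians) :
    (⨅ j, (W j).comap (D.proj j)) ∈ S.nullLagrangians := by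
  simp only [mem_nullLagrangians_iff] at hW ⊢
  have hmem : ∀ {x}, x ∈ (⨅ j, (W j).comap (D.proj j)) ↔ ∀ j, D.proj j x ∈ W j := by
    simp only [Submodule.mem_iInf, Submodule.mem_comap, implies_true]
  refine ⟨le_antisymm (fun x hx => hmem.2 fun j => ?_) fun x hx => ?_, fun x hx => ?_⟩
  · rw [← (hW j).1]
    refine LinearMap.BilinForm.mem_orthogonal_iff.2 fun y hy => ?_
    have hxy : S.ω y x = 0 := LinearMap.BilinForm.mem_orthogonal_iff.1 hx _
      (hmem.2 (D.forall_proj_coe_mem_iff.2 hy))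
    rwa [← S.isAlt.neg_eq, neg_eq_zero, D.ω_coe_right, ← neg_eq_zero,
      (D.subsystem j).isAlt.neg_eq] at hxy
  · refine LinearMap.BilinForm.mem_orthogonal_iff.2 fun y hy => (D.ω_eq_sum y x).trans ?_
    exact Finset.sum_eq_zero fun j _ =>
      (isLagrangian_iff.1 (hW j).1).1 _ (hmem.1 hy j) _ (hmem.1 hx j)
  · refine hmem.2 fun j => ?_
    rw [proj_vectorField]
    exact (hW j).2 (hmem.1 hx j)

/-- The Lagrangian subspaces in the null-cone of a split system are the direct sums of those of
the components. -/
def nullLagrangiansEquiv : S.nullLagrangians ≃ ∀ j, (D.subsystem j).nullLagrangians where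
  toFun W j := ⟨_, D.comap_mem_nullLagrangians W.2 j⟩
  invFun W := ⟨_, D.iInf_mem_nullLagrangians fun j => (W j).2⟩
  left_inv W := by
    ext x
    simp only [Submodule.mem_iInf, Submodule.mem_comap, Submodule.subtype_apply]
    exact (D.mem_iff_forall_proj_mem (mem_nullLagrangians_iff.1 W.2).2).symm
  right_inv W := by
    ext j y
    simp only [Submodule.mem_iInf, Submodule.mem_comap, Submodule.subtype_apply]
    exact D.forall_proj_coe_mem_iff (W := fun j => (W j : Submodule ℝ (D.comp j)))

theorem encard_nullLagrangians {n : Fin r → ℕ}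
    (h : ∀ j, (D.subsystem j).nullLagrangians.encard = n j) :
    S.nullLagrangians.encard = ((∏ j, n j : ℕ) : ℕ∞) := by
  have hfin : ∀ j, Finite (D.subsystem j).nullLagrangians := fun j =>
    Set.finite_of_encard_eq_coe (h j)
  have : Finite S.nullLagrangians := Finite.of_equiv _ D.nullLagrangiansEquiv.symm
  have hcard : ∀ j, Nat.card (D.subsystem j).nullLagrangians = n j := fun j => by
    rw [Nat.card_coe_set_eq, Set.ncard, h j, ENat.toNat_natCast]
  rw [← (Set.toFinite S.nullLagrangians).cast_ncard_eq, ← Nat.card_coe_set_eq,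
    Nat.card_congr D.nullLagrangiansEquiv, Nat.card_pi]
  simp_rw [hcard]

end Splitting

end NullLagrangians

end LinearHamiltonianSystem

section ReflectionFactors

variable {K : Type*} [Field K]

/-- The monic polynomials `p` for which `p(X) p(-X)` is `χ` up to a unit. When `χ` is the
characteristic polynomial of a nonderogatory Hamiltonian operator `L`, the map `p ↦ ker p(L)` is a
bijection onto the invariant Lagrangian subspaces. -/
def reflectionFactors (χ : K[X]) : Set K[X] :=
  {p | p.Monic ∧ Associated (p * p.comp (-X)) χ}

theorem dvd_of_mem_reflectionFactors {p χ : K[X]} (hp : p ∈ reflectionFactors χ) : p ∣ χ :=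
  (dvd_mul_right _ _).trans hp.2.dvd

theorem natDegree_of_mem_reflectionFactors {p χ : K[X]} (hp : p ∈ reflectionFactors χ) :
    2 * p.natDegree = χ.natDegree := by
  rw [← natDegree_eq_of_degree_eq (degree_eq_degree_of_associated hp.2), natDegree_mul',
    natDegree_comp_neg_X, two_mul]
  simpa using hp.1.ne_zero

theorem reflectionFactors_pow {p : K[X]} (hp : Irreducible p) (hmonic : p.Monic)
    (hrefl : p.comp (-X) = p) (k : ℕ) :
    reflectionFactors (p ^ k) = (p ^ ·) '' {i | 2 * i = k} := by
  ext f
  constructor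
  · intro hf
    obtain ⟨i, -, hi⟩ := (dvd_prime_pow hp.prime k).1 (dvd_of_mem_reflectionFactors hf)
    obtain rfl := eq_of_monic_of_associated hf.1 (hmonic.pow i) hi
    have hdeg := natDegree_of_mem_reflectionFactors hf
    rw [natDegree_pow, natDegree_pow, ← mul_assoc] at hdeg
    exact ⟨i, Nat.eq_of_mul_eq_mul_right hp.natDegree_pos hdeg, rfl⟩
  · rintro ⟨i, rfl, rfl⟩
    refine ⟨hmonic.pow i, ?_⟩
    rw [pow_comp, hrefl, ← pow_add, ← two_mul]

section Pair

variable {p q : K[X]} (hp : Irreducible p) (hq : Irreducible q) (hpm : p.Monic) (hqm : q.Monic)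
include hp hq hpm hqm

theorem reflectionFactors_mul_pow (hrefl : Associated (p.comp (-X)) q) (k : ℕ) :
    reflectionFactors ((p * q) ^ k) = (fun i => p ^ i * q ^ (k - i)) '' Set.Iic k := by
  have hdeg : q.natDegree = p.natDegree := by
    rw [← natDegree_eq_of_degree_eq (degree_eq_degree_of_associated hrefl),
      natDegree_comp_neg_X]
  ext f
  constructor
  · intro hf
    have hdvd := dvd_of_mem_reflectionFactors hf
    rw [mul_pow] at hdvd
    obtain ⟨a, b, ha, hb, rfl⟩ := exists_dvd_and_dvd_of_dvd_mul hdvd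
    obtain ⟨i, -, hi⟩ := (dvd_prime_pow hp.prime k).1 ha
    obtain ⟨j, -, hj⟩ := (dvd_prime_pow hq.prime k).1 hb
    have hab := eq_of_monic_of_associated hf.1 ((hpm.pow i).mul (hqm.pow j)) (hi.mul_mul hj)
    have hij := natDegree_of_mem_reflectionFactors hf
    rw [hab, (hpm.pow i).natDegree_mul (hqm.pow j), natDegree_pow, natDegree_pow, natDegree_pow,
      hpm.natDegree_mul hqm, hdeg, ← add_mul, ← two_mul, mul_left_comm k] at hij
    obtain rfl :=
      Nat.eq_of_mul_eq_mul_right hp.natDegree_pos (Nat.eq_of_mul_eq_mul_left two_pos hij)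
    exact ⟨i, Nat.le_add_right i j, by simp only [hab, Nat.add_sub_cancel_left]⟩
  · rintro ⟨i, hi, rfl⟩
    obtain ⟨j, rfl⟩ := Nat.exists_eq_add_of_le hi
    have hrefl' : Associated (q.comp (-X)) p := by
      have h := hrefl.map (compRingHom (-X))
      simp only [coe_compRingHom_apply, comp_neg_X_comp_neg_X] at h
      exact h.symm
    refine ⟨(hpm.pow i).mul (hqm.pow _), ?_⟩
    simp only [Nat.add_sub_cancel_left, mul_comp, pow_comp]
    have hmul : (p * q) ^ (i + j) = p ^ i * q ^ j * (q ^ i * p ^ j) := by ring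
    rw [hmul]
    exact (Associated.refl _).mul_mul (hrefl.pow_pow.mul_mul hrefl'.pow_pow)

theorem encard_reflectionFactors_mul_pow (hrefl : Associated (p.comp (-X)) q) (hne : p ≠ q)
    (k : ℕ) : (reflectionFactors ((p * q) ^ k)).encard = (k + 1 : ℕ) := by
  have hcop : IsCoprime p q := isCoprime_of_irreducible_of_monic_of_ne hp hq hpm hqm hne
  have hle : ∀ {i j}, p ^ i * q ^ (k - i) = p ^ j * q ^ (k - j) → i ≤ j := fun {i j} h =>
    (pow_dvd_pow_iff hp.ne_zero hp.not_isUnit).1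
      (hcop.pow.dvd_of_dvd_mul_right (h ▸ dvd_mul_right _ _))
  have hinj : Set.InjOn (fun i => p ^ i * q ^ (k - i)) (Set.Iic k) :=
    fun i _ j _ h => le_antisymm (hle h) (hle h.symm)
  rw [reflectionFactors_mul_pow hp hq hpm hqm hrefl, hinj.encard_image, ← Finset.coe_Iic,
    Set.encard_coe_eq_coe_finsetCard, Nat.card_Iic]

end Pair

end ReflectionFactors

namespace LinearHamiltonianSystem

section QuadrupletPolyFactors

variable {z : ℂ}

theorem minpoly_dvd_quadrupletPoly {w : ℂ} (h : w ∈ quadruplet z) :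
    minpoly ℝ w ∣ quadrupletPoly z :=
  minpoly.dvd _ _ (aeval_quadrupletPoly_eq_zero_iff.2 h)

theorem natDegree_sqPoly_le_natDegree_minpoly (z : ℂ) :
    (sqPoly z).natDegree ≤ (minpoly ℝ z).natDegree := by
  by_cases him : z.im = 0
  · rw [natDegree_sqPoly_eq_one_iff.2 (Or.inr him)]
    exact minpoly.natDegree_pos (IsIntegral.of_finite ℝ z)
  · refine (natDegree_sqPoly_le z).trans
      ((minpoly.two_le_natDegree_iff (IsIntegral.of_finite ℝ z)).2 ?_)
    rintro ⟨c, rfl⟩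
    exact him (Complex.ofReal_im c)

theorem quadrupletPoly_eq_minpoly (hz : z ≠ 0) (hre : z.re = 0) :
    quadrupletPoly z = minpoly ℝ z := by
  have hz' := IsIntegral.of_finite ℝ z
  refine eq_of_monic_of_associated (quadrupletPoly_monic z) (minpoly.monic hz')
    (associated_of_dvd_of_natDegree_le (minpoly_dvd_quadrupletPoly (mem_quadruplet_self z))
      (quadrupletPoly_monic z).ne_zero ?_).symm
  rw [natDegree_quadrupletPoly, natDegree_sqPoly_eq_one_iff.2 (Or.inl hre),
    minpoly.two_le_natDegree_iff hz']
  rintro ⟨c, rfl⟩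
  exact hz (congrArg _ hre)

theorem minpoly_ne_minpoly_neg (hre : z.re ≠ 0) : minpoly ℝ z ≠ minpoly ℝ (-z) := fun h => by
  have hdvd : minpoly ℝ z ∣ X ^ 2 - C (2 * z.re) * X + C (Complex.normSq z) :=
    minpoly.dvd _ _ (by rw [aeval_quadratic, sub_self, zero_mul])
  have hroot := aeval_eq_zero_of_dvd_aeval_eq_zero hdvd (h ▸ minpoly.aeval ℝ (-z))
  rw [aeval_quadratic, mul_eq_zero, sub_eq_zero, sub_eq_zero] at hroot
  refine hre (self_eq_neg.1 ?_)
  rcases hroot with h | h <;> simpa using (congrArg Complex.re h).symm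

theorem associated_minpoly_comp_neg_X (z : ℂ) :
    Associated ((minpoly ℝ z).comp (-X)) (minpoly ℝ (-z)) := by
  rw [minpoly.neg]
  exact associated_unit_mul_right _ _ (isUnit_one.neg.pow _)

theorem quadrupletPoly_eq_mul (hre : z.re ≠ 0) :
    quadrupletPoly z = minpoly ℝ z * minpoly ℝ (-z) := by
  have hz := IsIntegral.of_finite ℝ z
  have hz' := IsIntegral.of_finite ℝ (-z)
  have hcop : IsCoprime (minpoly ℝ z) (minpoly ℝ (-z)) :=
    isCoprime_of_irreducible_of_monic_of_ne (minpoly.irreducible hz) (minpoly.irreducible hz')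
      (minpoly.monic hz) (minpoly.monic hz') (minpoly_ne_minpoly_neg hre)
  have hdeg : (minpoly ℝ (-z)).natDegree = (minpoly ℝ z).natDegree := by
    rw [← natDegree_eq_of_degree_eq
      (degree_eq_degree_of_associated (associated_minpoly_comp_neg_X z)),
      natDegree_comp_neg_X]
  refine (eq_of_monic_of_associated ((minpoly.monic hz).mul (minpoly.monic hz'))
    (quadrupletPoly_monic z) (associated_of_dvd_of_natDegree_le
      (hcop.mul_dvd (minpoly_dvd_quadrupletPoly (mem_quadruplet_self z))
        (minpoly_dvd_quadrupletPoly (Or.inr (Or.inl rfl)))) (quadrupletPoly_monic z).ne_zero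
      ?_)).symm
  rw [(minpoly.monic hz).natDegree_mul (minpoly.monic hz'), hdeg, natDegree_quadrupletPoly,
    ← two_mul]
  exact Nat.mul_le_mul_left 2 (natDegree_sqPoly_le_natDegree_minpoly z)

theorem encard_reflectionFactors_quadrupletPoly_pow_of_re_ne_zero (hre : z.re ≠ 0) (k : ℕ) :
    (reflectionFactors (quadrupletPoly z ^ k)).encard = (k + 1 : ℕ) := by
  have hz := IsIntegral.of_finite ℝ z
  have hz' := IsIntegral.of_finite ℝ (-z)
  rw [quadrupletPoly_eq_mul hre]
  exact encard_reflectionFactors_mul_pow (minpoly.irreducible hz) (minpoly.irreducible hz')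
    (minpoly.monic hz) (minpoly.monic hz') (associated_minpoly_comp_neg_X z)
    (minpoly_ne_minpoly_neg hre) k

theorem reflectionFactors_quadrupletPoly_pow_of_re_eq_zero (hz : z ≠ 0) (hre : z.re = 0) (k : ℕ) :
    reflectionFactors (quadrupletPoly z ^ k) = (quadrupletPoly z ^ ·) '' {i | 2 * i = k} := by
  have hz' := minpoly.irreducible (IsIntegral.of_finite ℝ z)
  rw [← quadrupletPoly_eq_minpoly hz hre] at hz'
  exact reflectionFactors_pow hz' (quadrupletPoly_monic z) (quadrupletPoly_comp_neg_X z) k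

theorem encard_reflectionFactors_quadrupletPoly_pow (hz : z ≠ 0) {k : ℕ} (hk : 0 < k)
    (hle : (quadrupletPoly z ^ k).natDegree ≤ 4) :
    (reflectionFactors (quadrupletPoly z ^ k)).encard =
      factor (quadrupletPoly z ^ k).natDegree z := by
  have hone := natDegree_sqPoly_eq_one_iff (z := z)
  rw [natDegree_pow, natDegree_quadrupletPoly] at hle ⊢
  by_cases hreal : z.re = 0 ∨ z.im = 0
  · rw [hone.2 hreal] at hle ⊢
    have hk2 : k ≤ 2 := by omega
    by_cases hre : z.re = 0
    · rw [reflectionFactors_quadrupletPoly_pow_of_re_eq_zero hz hre]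
      interval_cases k <;> simp [factor, hre]
    · have him := hreal.resolve_left hre
      rw [encard_reflectionFactors_quadrupletPoly_pow_of_re_ne_zero hre]
      interval_cases k <;> simp [factor, hre, him]
  · have hd : (sqPoly z).natDegree = 2 :=
      le_antisymm (natDegree_sqPoly_le z)
        (lt_of_le_of_ne (natDegree_sqPoly_pos z) fun h => hreal (hone.1 h.symm))
    rw [hd] at hle ⊢
    obtain rfl : k = 1 := by omega
    obtain ⟨hre, him⟩ := not_or.1 hreal
    rw [encard_reflectionFactors_quadrupletPoly_pow_of_re_ne_zero hre]
    simp [factor, hre, him]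

end QuadrupletPolyFactors

variable {V : Type*} [AddCommGroup V] [Module ℝ V] [FiniteDimensional ℝ V]
  {S : LinearHamiltonianSystem V}

theorem nullLagrangians_eq_image (hL : IsNonderogatory S.vectorField) :
    S.nullLagrangians = (fun p => LinearMap.ker (aeval S.vectorField p)) ''
      reflectionFactors S.vectorField.charpoly := by
  have hiff : ∀ {p}, p ∣ S.vectorField.charpoly →
      (S.IsLagrangian (LinearMap.ker (aeval S.vectorField p)) ↔
        Associated (p * p.comp (-X)) S.vectorField.charpoly) := fun hp =>
    orthogonal_ker_aeval_eq_self_iff S.nondegenerate S.isSkewAdjoint_vectorField hL hp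
  ext W
  rw [mem_nullLagrangians_iff]
  constructor
  · rintro ⟨hW, hinv⟩
    obtain ⟨p, hmonic, hp, rfl⟩ := hL.exists_eq_ker_aeval hinv
    exact ⟨p, ⟨hmonic, (hiff hp).1 hW⟩, rfl⟩
  · rintro ⟨p, hp, rfl⟩
    exact ⟨(hiff (dvd_of_mem_reflectionFactors hp)).2 hp.2, ker_aeval_mem_invtSubmodule _ p⟩

theorem encard_nullLagrangians_eq (hL : IsNonderogatory S.vectorField) :
    S.nullLagrangians.encard = (reflectionFactors S.vectorField.charpoly).encard := by
  rw [nullLagrangians_eq_image hL]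
  refine Set.InjOn.encard_image fun p hp q hq h => ?_
  have hdvd : ∀ {p q}, p ∈ reflectionFactors S.vectorField.charpoly →
      LinearMap.ker (aeval S.vectorField p) = LinearMap.ker (aeval S.vectorField q) → p ∣ q :=
    fun hp h => hL.dvd_of_ker_aeval_le hp.1.ne_zero
      (hL.finrank_ker_aeval (dvd_of_mem_reflectionFactors hp)).ge h.le
  exact eq_of_monic_of_associated hp.1 hq.1
    (associated_of_dvd_dvd (hdvd hp h) (hdvd hq h.symm))

section Multiplicity

variable {z : ℂ}

theorem rootMultiplicity_quadrupletPoly (hz : z ≠ 0) :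
    ((quadrupletPoly z).map (algebraMap ℝ ℂ)).rootMultiplicity z = 1 := by
  have hne : (quadrupletPoly z).map (algebraMap ℝ ℂ) ≠ 0 :=
    ((quadrupletPoly_monic z).map _).ne_zero
  have hroot : aeval z (quadrupletPoly z) = 0 :=
    aeval_quadrupletPoly_eq_zero_iff.2 (mem_quadruplet_self z)
  refine le_antisymm (not_lt.1 fun h => ?_)
    ((rootMultiplicity_pos hne).2 (by rwa [IsRoot, eval_map_algebraMap]))
  have hsep := (sqPoly_irreducible z).separable.aeval_derivative_ne_zero (minpoly.aeval ℝ (z ^ 2))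
  have hder := ((one_lt_rootMultiplicity_iff_isRoot hne).1 h).2
  rw [derivative_map, IsRoot, eval_map_algebraMap, quadrupletPoly, derivative_comp, map_mul,
    aeval_comp, aeval_X_pow, derivative_X_pow, mul_eq_zero] at hder
  refine hder.elim ?_ hsep
  simp [hz]

end Multiplicity

variable {z : ℂ}

theorem ne_zero_of_mem_eigenvalues (hker : LinearMap.ker S.vectorField = ⊥)
    (hz : z ∈ S.eigenvalues) : z ≠ 0 := by
  rintro rfl
  exact S.ker_vectorField_eq_bot_iff.1 hker hz

theorem finrank_eigenspace_sq_le (hz : z ≠ 0) :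
    finrank ℂ (S.complexVectorField.eigenspace z) ^ 2 ≤ finrank ℝ S.centralizer := by
  have hskew : (S.ω.baseChange ℂ).IsSkewAdjoint S.complexVectorField :=
    isSkewAdjoint_baseChange S.isSkewAdjoint_vectorField
  have hnon := nondegenerate_baseChange (L := ℂ) S.nondegenerate
  have hmul := finrank_eigenspace_mul_le hnon (isAlt_baseChange S.isAlt) hskew hz
  rw [finrank_eigenspace_neg hnon hskew, ← pow_two] at hmul
  exact hmul.trans finrank_skewCentralizer_baseChange_le

theorem isNonderogatory_complexVectorField (hker : LinearMap.ker S.vectorField = ⊥)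
    (hC : finrank ℝ S.centralizer < 4) : IsNonderogatory S.complexVectorField := by
  refine isNonderogatory_of_finrank_eigenspace_le_one fun a => ?_
  by_contra! h
  have ha := ne_zero_of_mem_eigenvalues hker (S.mem_eigenvalues_iff_finrank.2 (one_pos.trans h))
  have hsq := finrank_eigenspace_sq_le (S := S) ha
  nlinarith

/-- The systems occurring as components of a system of codimension at most one: a single
quadruplet of nonzero eigenvalues with one-dimensional eigenspaces, in dimension at most four. -/
structure IsSimpleBlock (S : LinearHamiltonianSystem V) (z : ℂ) : Prop where
  eigenvalues_eq : S.eigenvalues = quadruplet z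
  ne_zero : z ≠ 0
  isNonderogatory : IsNonderogatory S.complexVectorField
  finrank_le : finrank ℝ V ≤ 4

theorem exists_charpoly_eq_quadrupletPoly_pow_pos (hS : S.eigenvalues = quadruplet z) :
    ∃ k, 0 < k ∧ S.vectorField.charpoly = quadrupletPoly z ^ k ∧
      finrank ℝ V = 2 * ((sqPoly z).natDegree * k) := by
  obtain ⟨k, hk⟩ := S.exists_charpoly_eq_quadrupletPoly_pow hS.le
  refine ⟨k, Nat.pos_of_ne_zero fun h0 => ?_, hk, ?_⟩
  · have hz := S.mem_eigenvalues_iff_aeval_charpoly.1 (hS.ge (mem_quadruplet_self z))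
    rw [hk, h0, pow_zero, map_one] at hz
    exact one_ne_zero hz
  · rw [← S.vectorField.charpoly_natDegree, hk, natDegree_pow, natDegree_quadrupletPoly]
    ring

theorem isSimpleBlock_of_codimension_le_one (hS : S.eigenvalues = quadruplet z)
    (hker : LinearMap.ker S.vectorField = ⊥) (hcodim : S.codimension ≤ 1) :
    S.IsSimpleBlock z := by
  obtain ⟨k, hk, -, hdim⟩ := exists_charpoly_eq_quadrupletPoly_pow_pos hS
  have hd := natDegree_sqPoly_le z
  have hm : S.moduliNumber ≤ (sqPoly z).natDegree :=
    S.moduliNumber_le_natDegree (sqPoly_monic z).ne_zero fun w hw _ =>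
      aeval_sqPoly_eq_zero_iff.2 (hS.le hw)
  have hC : finrank ℝ S.centralizer ≤ (sqPoly z).natDegree + 1 := by
    rw [codimension_eq] at hcodim
    omega
  have hL := isNonderogatory_complexVectorField hker (by omega)
  have hle := S.finrank_le_two_mul_finrank_centralizer hker (isNonderogatory_of_baseChange hL)
  refine ⟨hS, ne_zero_of_mem_eigenvalues hker (hS.ge (mem_quadruplet_self z)), hL, ?_⟩
  interval_cases (sqPoly z).natDegree <;> omega

namespace IsSimpleBlock

theorem finrank_eq (h : S.IsSimpleBlock z) : finrank ℝ V = 2 ∨ finrank ℝ V = 4 := by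
  obtain ⟨k, hk, -, hdim⟩ := exists_charpoly_eq_quadrupletPoly_pow_pos h.eigenvalues_eq
  have hpos := Nat.mul_pos (natDegree_sqPoly_pos z) hk
  have hle := h.finrank_le
  omega

theorem re_eq_zero_or_im_eq_zero (h : S.IsSimpleBlock z) (h2 : finrank ℝ V = 2) :
    z.re = 0 ∨ z.im = 0 := by
  obtain ⟨k, -, -, hdim⟩ := exists_charpoly_eq_quadrupletPoly_pow_pos h.eigenvalues_eq
  exact natDegree_sqPoly_eq_one_iff.1 (Nat.eq_one_of_mul_eq_one_right (by omega : _ * k = 1))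

theorem geomMultiplicity_eq_one (h : S.IsSimpleBlock z) : S.geomMultiplicity z = 1 :=
  le_antisymm (h.isNonderogatory.finrank_eigenspace_le_one z) <|
    S.mem_eigenvalues_iff_finrank.1 (h.eigenvalues_eq.ge (mem_quadruplet_self z))

theorem algMultiplicity_eq_two (h : S.IsSimpleBlock z) (h4 : finrank ℝ V = 4)
    (hz : z.re = 0 ∨ z.im = 0) : S.algMultiplicity z = 2 := by
  obtain ⟨k, -, hchar, hdim⟩ := exists_charpoly_eq_quadrupletPoly_pow_pos h.eigenvalues_eq
  rw [algMultiplicity, complexVectorField, LinearMap.charpoly_baseChange, hchar, Polynomial.map_pow,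
    ← count_roots, roots_pow, Multiset.count_nsmul, count_roots,
    rootMultiplicity_quadrupletPoly h.ne_zero]
  rw [natDegree_sqPoly_eq_one_iff.2 hz] at hdim
  omega

theorem encard_nullLagrangians (h : S.IsSimpleBlock z) :
    S.nullLagrangians.encard = factor (finrank ℝ V) z := by
  obtain ⟨k, hk, hchar, -⟩ := exists_charpoly_eq_quadrupletPoly_pow_pos h.eigenvalues_eq
  have hdim := S.vectorField.charpoly_natDegree
  rw [hchar] at hdim
  rw [encard_nullLagrangians_eq (isNonderogatory_of_baseChange h.isNonderogatory), hchar, ← hdim]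
  exact encard_reflectionFactors_quadrupletPoly_pow h.ne_zero hk (hdim ▸ h.finrank_le)

end IsSimpleBlock

theorem Splitting.isSimpleBlock {r : ℕ} (D : S.Splitting r) (hsig : Even S.signature)
    (hcodim : S.codimension ≤ 1) (j : Fin r) : (D.subsystem j).IsSimpleBlock (D.eigenvalue j) :=
  isSimpleBlock_of_codimension_le_one (D.eigenvalues_eq j)
    (D.ker_vectorField_subsystem_eq_bot (S.ker_vectorField_eq_bot hsig hcodim) j)
    ((D.codimension_subsystem_le j).trans hcodim)

variable (S)

theorem vectorField_restrict_coe {W : Submodule ℝ V} (hW : (S.ω.restrict W).Nondegenerate)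
    (hinv : W ∈ S.vectorField.invtSubmodule) (y : W) :
    S.vectorField y = (S.restrict W hW).vectorField y := by
  have h : (⟨S.vectorField y, hinv y.2⟩ : W) = (S.restrict W hW).vectorField y := by
    refine sub_eq_zero.1 (hW.2 _ fun x => ?_)
    rw [map_sub, sub_eq_zero]
    refine (S.ω_vectorField x y).trans (Eq.trans ?_ ((S.restrict W hW).ω_vectorField x y).symm)
    exact (LinearMap.congr_fun₂ (QuadraticMap.associated_comp ℝ S.H W.subtype) x y).symm
  exact congrArg Subtype.val h

theorem ker_aeval_vectorField_ne_bot {z : ℂ} (hz : z ∈ S.eigenvalues) {p : ℝ[X]}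
    (hp : aeval z p = 0) : LinearMap.ker (aeval S.vectorField p) ≠ ⊥ := fun h => by
  have hinj : Function.Injective ((aeval S.vectorField p).baseChange ℂ) :=
    Module.Flat.lTensor_preserves_injective_linearMap _ (LinearMap.ker_eq_bot.1 h)
  obtain ⟨x, hx⟩ := End.HasEigenvalue.exists_hasEigenvector hz
  have hx0 := End.aeval_apply_of_hasEigenvector (p := p.map (algebraMap ℝ ℂ)) hx
  rw [aeval_map_algebraMap, complexVectorField, aeval_baseChange, eval_map_algebraMap, hp,
    zero_smul] at hx0
  exact hx.2 (hinj (hx0.trans (map_zero _).symm))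

theorem eigenvalues_eq_quadruplet [Nontrivial V] {z : ℂ} (hS : S.eigenvalues ⊆ quadruplet z) :
    S.eigenvalues = quadruplet z := by
  obtain ⟨k, hk⟩ := S.exists_charpoly_eq_quadrupletPoly_pow hS
  have hk0 : k ≠ 0 := by
    rintro rfl
    have h := S.vectorField.charpoly_natDegree
    rw [hk, pow_zero, natDegree_one] at h
    exact finrank_pos.ne h
  ext w
  rw [mem_eigenvalues_iff_aeval_charpoly, hk, map_pow, pow_eq_zero_iff hk0,
    aeval_quadrupletPoly_eq_zero_iff]

section EvenPolynomials

variable {p q : ℝ[X]} (hp : p.comp (-X) = p) (hpq : IsCoprime p q)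
include hp

theorem isAdjointPair_aeval_vectorField :
    LinearMap.IsAdjointPair S.ω S.ω (aeval S.vectorField p) (aeval S.vectorField p) := by
  have h := isAdjointPair_aeval_comp_neg_X S.isSkewAdjoint_vectorField p
  rwa [hp] at h

include hpq

theorem ω_eq_zero_of_isCoprime {x y : V} (hx : x ∈ LinearMap.ker (aeval S.vectorField p))
    (hy : y ∈ LinearMap.ker (aeval S.vectorField q)) : S.ω x y = 0 := by
  obtain ⟨a, b, hab⟩ := hpq
  have h := LinearMap.congr_fun (congrArg (aeval S.vectorField) hab) y
  rw [map_add, mul_comm a, map_mul, map_mul, LinearMap.add_apply, End.mul_apply, End.mul_apply,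
    LinearMap.mem_ker.1 hy, map_zero, add_zero, map_one, End.one_apply] at h
  rw [← h, ← S.isAdjointPair_aeval_vectorField hp, LinearMap.mem_ker.1 hx, map_zero,
    LinearMap.zero_apply]

theorem nondegenerate_restrict_ker_aeval (h : aeval S.vectorField (p * q) = 0) :
    (S.ω.restrict (LinearMap.ker (aeval S.vectorField p))).Nondegenerate := by
  refine BilinForm.nondegenerate_restrict_of_disjoint_orthogonal S.ω S.isAlt.isRefl ?_
  rw [orthogonal_ker_of_isAdjointPair S.nondegenerate (S.isAdjointPair_aeval_vectorField hp)]
  refine (disjoint_ker_aeval_of_isCoprime _ hpq).mono_right (LinearMap.range_le_ker_iff.2 ?_)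
  rwa [mul_comm, map_mul] at h

end EvenPolynomials

section PrimaryComponents

/-- The sum of the generalized eigenspaces of the eigenvalues in the quadruplet of `z`. -/
def primaryComponent (z : ℂ) : Submodule ℝ V :=
  LinearMap.ker (aeval S.vectorField (quadrupletPoly z ^ finrank ℝ V))

theorem quadrupletPoly_pow_comp_neg_X (z : ℂ) (k : ℕ) :
    (quadrupletPoly z ^ k).comp (-X) = quadrupletPoly z ^ k := by
  rw [pow_comp, quadrupletPoly_comp_neg_X]

theorem primaryComponent_mem_invtSubmodule (z : ℂ) :
    S.primaryComponent z ∈ S.vectorField.invtSubmodule :=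
  ker_aeval_mem_invtSubmodule _ _

theorem eigenvalues_restrict_primaryComponent {z : ℂ} (hz : z ∈ S.eigenvalues)
    (hW : (S.ω.restrict (S.primaryComponent z)).Nondegenerate) :
    (S.restrict (S.primaryComponent z) hW).eigenvalues = quadruplet z := by
  have hpos : 0 < finrank ℝ V := S.vectorField.charpoly_natDegree ▸ natDegree_pos_iff_degree_pos.2
    (degree_pos_of_aeval_root S.vectorField.charpoly_monic.ne_zero
      (S.mem_eigenvalues_iff_aeval_charpoly.1 hz) fun _ => (algebraMap ℝ ℂ).injective.eq_iff.1)
  have hne : S.primaryComponent z ≠ ⊥ := S.ker_aeval_vectorField_ne_bot hz (by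
    rw [map_pow, aeval_quadrupletPoly_eq_zero_iff.2 (mem_quadruplet_self z), zero_pow hpos.ne'])
  have : Nontrivial (S.primaryComponent z) := Submodule.nontrivial_iff_ne_bot.2 hne
  refine eigenvalues_eq_quadruplet _ fun w hw => aeval_quadrupletPoly_eq_zero_iff.1 ?_
  have hzero : aeval (S.restrict (S.primaryComponent z) hW).vectorField
      (quadrupletPoly z ^ finrank ℝ V) = 0 := by
    ext y
    exact (aeval_apply_of_intertwine (i := (S.primaryComponent z).subtype)
      (S.vectorField_restrict_coe hW (S.primaryComponent_mem_invtSubmodule z)) _ y).symm.trans y.2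
  have h := aeval_eq_zero_of_mem_eigenvalues _ hw hzero
  rw [map_pow] at h
  exact eq_zero_of_pow_eq_zero h

theorem exists_quadruplet_representatives : ∃ (r : ℕ) (z : Fin r → ℂ),
    (∀ j, z j ∈ S.eigenvalues) ∧ Function.Injective (quadruplet ∘ z) ∧
      ∀ w ∈ S.eigenvalues, ∃ j, w ∈ quadruplet (z j) := by
  obtain ⟨T, hT, hbij⟩ := Set.exists_subset_bijOn S.eigenvalues quadruplet
  have : Finite T := S.finite_eigenvalues.subset hT
  obtain ⟨r, ⟨e⟩⟩ := Finite.exists_equiv_fin T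
  refine ⟨r, fun j => e.symm j, fun j => hT (e.symm j).2, fun i j h => ?_, fun w hw => ?_⟩
  · exact e.symm.injective (Subtype.ext (hbij.injOn (e.symm i).2 (e.symm j).2 h))
  · obtain ⟨t, ht, htw⟩ := hbij.surjOn (Set.mem_image_of_mem _ hw)
    exact ⟨e ⟨t, ht⟩, by simpa [htw] using mem_quadruplet_self w⟩

theorem aeval_prod_quadrupletPoly_pow_eq_zero {r : ℕ} {z : Fin r → ℂ}
    (hz : ∀ w ∈ S.eigenvalues, ∃ j, w ∈ quadruplet (z j)) :
    aeval S.vectorField (∏ j, quadrupletPoly (z j) ^ finrank ℝ V) = 0 := by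
  have hdvd : S.vectorField.charpoly ∣ (∏ j, quadrupletPoly (z j)) ^ finrank ℝ V := by
    rw [← S.vectorField.charpoly_natDegree]
    refine dvd_pow_natDegree_of_aeval_eq_zero ℂ S.vectorField.charpoly_monic.ne_zero fun w hw => ?_
    obtain ⟨j, hj⟩ := hz w (S.mem_eigenvalues_iff_aeval_charpoly.2 hw)
    rw [map_prod]
    exact Finset.prod_eq_zero (Finset.mem_univ j) (aeval_quadrupletPoly_eq_zero_iff.2 hj)
  rw [Finset.prod_pow]
  exact aeval_eq_zero_of_dvd_aeval_eq_zero hdvd S.vectorField.aeval_self_charpoly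

theorem exists_splitting : ∃ r : ℕ, Nonempty (S.Splitting r) := by
  obtain ⟨r, z, hz, hinj, hcover⟩ := S.exists_quadruplet_representatives
  let P : Fin r → ℝ[X] := fun j => quadrupletPoly (z j) ^ finrank ℝ V
  have hcop : Pairwise fun i j => IsCoprime (P i) (P j) := fun i j hij =>
    (isCoprime_quadrupletPoly (hinj.ne hij)).pow
  have hzero : aeval S.vectorField (∏ j, P j) = 0 :=
    S.aeval_prod_quadrupletPoly_pow_eq_zero hcover
  have hω : ∀ i j, i ≠ j → ∀ x ∈ S.primaryComponent (z i), ∀ y ∈ S.primaryComponent (z j),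
      S.ω x y = 0 := fun i j hij _ hx _ hy =>
    S.ω_eq_zero_of_isCoprime (quadrupletPoly_pow_comp_neg_X _ _) (hcop hij) hx hy
  have hsymp : ∀ j, (S.ω.restrict (S.primaryComponent (z j))).Nondegenerate := fun j =>
    S.nondegenerate_restrict_ker_aeval (q := ∏ i ∈ Finset.univ.erase j, P i)
      (quadrupletPoly_pow_comp_neg_X _ _)
      (IsCoprime.prod_right fun i hi => hcop (Finset.ne_of_mem_erase hi).symm)
      ((congrArg _ (Finset.mul_prod_erase _ P (Finset.mem_univ j))).trans hzero)
  refine ⟨r, ⟨⟨fun j => S.primaryComponent (z j), isInternal_ker_aeval hcop hzero, hsymp, hω,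
    fun i j hij x hx y hy => ?_, z,
    fun j => S.eigenvalues_restrict_primaryComponent (hz j) (hsymp j), fun i j => hinj.ne⟩⟩⟩
  refine QuadraticMap.associated_isOrtho.1 ((S.ω_vectorField x y).symm.trans ?_)
  exact hω i j hij x hx _ (S.primaryComponent_mem_invtSubmodule (z j) hy)

end PrimaryComponents

end LinearHamiltonianSystem

end

theorem mainTheorem4_general {V : Type*} [AddCommGroup V] [Module ℝ V] [FiniteDimensional ℝ V]
    (S : LinearHamiltonianSystem V)
    (hsig : Even S.signature)
    (hcodim : S.codimension ≤ 1) :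
    (∃ r : ℕ, Nonempty (S.Splitting r)) ∧
    ∀ (r : ℕ) (D : S.Splitting r),
      (∀ j : Fin r,
        (Module.finrank ℝ (D.comp j) = 2 ∨ Module.finrank ℝ (D.comp j) = 4) ∧
        D.eigenvalue j ≠ 0 ∧
        (Module.finrank ℝ (D.comp j) = 2 →
          (D.eigenvalue j).re = 0 ∨ (D.eigenvalue j).im = 0) ∧
        (Module.finrank ℝ (D.comp j) = 4 →
          (D.eigenvalue j).re = 0 ∨ (D.eigenvalue j).im = 0 →
          (D.subsystem j).algMultiplicity (D.eigenvalue j) = 2 ∧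
          (D.subsystem j).geomMultiplicity (D.eigenvalue j) = 1)) ∧
      {W : Submodule ℝ V | S.IsLagrangian W ∧ (W : Set V) ⊆ S.nullCone}.encard =
        ((∏ j : Fin r, D.δ j : ℕ) : ℕ∞) := by
  refine ⟨S.exists_splitting, fun r D => ⟨fun j => ?_, ?_⟩⟩
  · have h := D.isSimpleBlock hsig hcodim j
    exact ⟨h.finrank_eq, h.ne_zero, h.re_eq_zero_or_im_eq_zero,
      fun h4 hz => ⟨h.algMultiplicity_eq_two h4 hz, h.geomMultiplicity_eq_one⟩⟩
  · exact D.encard_nullLagrangians fun j => (D.isSimpleBlock hsig hcodim j).encard_nullLagrangians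

theorem mainTheorem4 {V : Type*} [AddCommGroup V] [Module ℝ V] [FiniteDimensional ℝ V]
    (S : LinearHamiltonianSystem V)
    (hsig : S.signature = 0)
    (hcodim : S.codimension ≤ 1) :
    (∃ r : ℕ, Nonempty (S.Splitting r)) ∧
    ∀ (r : ℕ) (D : S.Splitting r),
      (∀ j : Fin r,
        (Module.finrank ℝ (D.comp j) = 2 ∨ Module.finrank ℝ (D.comp j) = 4) ∧
        D.eigenvalue j ≠ 0 ∧
        (Module.finrank ℝ (D.comp j) = 2 →
          (D.eigenvalue j).re = 0 ∨ (D.eigenvalue j).im = 0) ∧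
        (Module.finrank ℝ (D.comp j) = 4 →
          (D.eigenvalue j).re = 0 ∨ (D.eigenvalue j).im = 0 →
          (D.subsystem j).algMultiplicity (D.eigenvalue j) = 2 ∧
          (D.subsystem j).geomMultiplicity (D.eigenvalue j) = 1)) ∧
      {W : Submodule ℝ V | S.IsLagrangian W ∧ (W : Set V) ⊆ S.nullCone}.encard =
        ((∏ j : Fin r, D.δ j : ℕ) : ℕ∞) :=
  mainTheorem4_general S (by simp [hsig]) hcodim
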